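/- **Definitions.** A (signed) bipartite graph $G=(V,E,\mathcal E)$ is a finite graph, possibly disconnected and possibly with multiple edges, with colour classes $V$ and $E$ and edge set $\mathcal E$, every edge joining an element of $V$ to an element of $E$ (and, in the signed case, with a sign map $\mathcal E\to\{+1,-1\}$). The elements of $E$ are called hyperedges. Let $G$ be connected. A *hypertree* is a function $f$ on $E$ for which there is a spanning tree of $G$ that has degree $f(e)+1$ at every $e\in E$. Fix a linear order on $E$. A hyperedge $e$ is *internally inactive* with respect to a hypertree $f$ if there is a smaller hyperedge $e'$ such that decreasing $f(e)$ by $1$ and increasing $f(e')$ by $1$ yields another hypertree; $\bar\iota(f)$ is the number of internally inactive hyperedges. The *interior polynomial* of $G$ is $I_G(x)=\sum_f x^{\bar\iota(f)}$, the sum being over all hypertrees (so $I_G=1$ if $G$ has only one vertex). For a possibly disconnected, non-empty $G$ with components $G_1,\dots,G_k$, put $I'_G(x)=(1-x)^{k-1}\prod_{i=1}^{k} I_{G_i}(x)$. For a signed bipartite graph $G$ with set of negative edges $\mathcal E_-(G)$, put $$I^+_G(x)=\sum_{\mathcal S\subseteq\mathcal E_-(G)}(-1)^{|\mathcal S|}\,I'_{G\setminus\mathcal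 S}(x),$$ where $G\setminus\mathcal S$ is obtained by deleting the edges in $\mathcal S$ and forgetting the signs. **Theorem.** Let $G_1=(V_1,E_1,\mathcal E_1)$ and $G_2=(V_2,E_2,\mathcal E_2)$ be signed bipartite graphs that have exactly one vertex $v$ and no edge in common, where either $v\in V_1\cap V_2$ or $v\in E_1\cap E_2$. Let $G_1*G_2=(V_1\cup V_2,\,E_1\cup E_2,\,\mathcal E_1\cup\mathcal E_2)$ be their block sum, with the signs inherited from $G_1$ and $G_2$. Then $$I^+_{G_1*G_2}(x)=I^+_{G_1}(x)\,I^+_{G_2}(x),$$ and, for the underlying unsigned bipartite graphs, $$I'_{G_1*G_2}(x)=I'_{G_1}(x)\,I'_{G_2}(x).$$ Both identities hold whatever linear orders on $E_1$, $E_2$ and $E_1\cup E_2$ are used to compute the polynomials. -/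

import Mathlib

open Polynomial
open scoped Graph

/-! Finite bipartite multigraphs are terms `G : Graph α β` together with a set `A` of vertices such
that every edge has exactly one end in `A`.  The colour class `E` of hyperedges is `V(G) ∩ A`, the
colour class `V` is `V(G) \ A`. -/

namespace InteriorPoly

variable {α β : Type*}

/-- The set `A` induces a proper 2-colouring of `G`: every edge has one end in `A` and one end
outside `A`. -/
def IsBipartition (G : Graph α β) (A : Set α) : Prop :=
  ∀ ⦃e : β⦄ ⦃x y : α⦄, G.IsLink e x y → (x ∈ A ↔ y ∉ A)

/-- The union of two multigraphs.  An edge that belongs to both graphs gets its ends from `G₁`;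
the union is only used for graphs without common edges.  If the two graphs share exactly one
vertex, this is their block sum at that vertex. -/
def blockSum (G₁ G₂ : Graph α β) : Graph α β where
  vertexSet := G₁.vertexSet ∪ G₂.vertexSet
  IsLink e x y := G₁.IsLink e x y ∨ (e ∉ G₁.edgeSet ∧ G₂.IsLink e x y)
  isLink_symm e _ := ⟨fun _ _ h => h.imp (fun h => h.symm) (fun h => ⟨h.1, h.2.symm⟩)⟩
  eq_or_eq_of_isLink_of_isLink := by
    rintro e x y z w (h | ⟨h, h'⟩) (k | ⟨k, k'⟩)
    · exact h.left_eq_or_eq k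
    · exact absurd h.edge_mem k
    · exact absurd k.edge_mem h
    · exact h'.left_eq_or_eq k'
  left_mem_of_isLink := by
    rintro e x y (h | ⟨_, h⟩)
    · exact Or.inl h.left_mem
    · exact Or.inr h.left_mem

/-- A multigraph is a tree if it has no loops and no parallel edges and is a tree as a simple
graph. -/
def IsTree (T : Graph α β) : Prop :=
  T.Simple ∧ T.toSimpleGraph.IsTree

/-- The degree of `x`, as the number of incident edges (only used for graphs without loops). -/
noncomputable def degree (G : Graph α β) (x : α) : ℕ :=
  (G.incidenceSet x).ncard

/-- `f` is a hypertree of the connected bipartite graph `G` with hyperedge class `V(G) ∩ A`: there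
is a spanning tree of `G` whose degree at each hyperedge `x` is `f x + 1`.  A hypertree is a function
on the hyperedges; here it is extended by zero to all of `α`.  Its values are non-negative, unless
`G` consists of one isolated hyperedge; integer values are used so that this graph, like every
one-vertex graph, has exactly one hypertree and hence interior polynomial `1`. -/
def IsHypertree (G : Graph α β) (A : Set α) (f : α → ℤ) : Prop :=
  (∀ x, x ∉ G.vertexSet ∩ A → f x = 0) ∧
    ∃ T : Graph α β, T ≤s G ∧ IsTree T ∧ ∀ x ∈ G.vertexSet ∩ A, (degree T x : ℤ) = f x + 1

open Classical in
/-- The function obtained from `f` by decreasing the value at `x` by one and increasing the value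
at `y` by one. -/
noncomputable def transfer (f : α → ℤ) (x y : α) : α → ℤ :=
  f - Pi.single x 1 + Pi.single y 1

/-- The hyperedges that are internally inactive with respect to the hypertree `f` and the order `o`:
those that can transfer one unit of valence to some smaller hyperedge so that another hypertree
results. -/
def internallyInactive (G : Graph α β) (A : Set α) (o : LinearOrder α) (f : α → ℤ) : Set α :=
  {x | x ∈ G.vertexSet ∩ A ∧
    ∃ y ∈ G.vertexSet ∩ A, o.lt y x ∧ IsHypertree G A (transfer f x y)}

/-- The interior polynomial `I_G` of a connected bipartite graph: the generating function of the
hypertrees by the number of internally inactive hyperedges. -/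
noncomputable def interior (G : Graph α β) (A : Set α) (o : LinearOrder α) : ℤ[X] :=
  ∑ᶠ (f : α → ℤ) (_ : IsHypertree G A f), X ^ (internallyInactive G A o f).ncard

/-- The set of connected components of `G`, as subgraphs of `G`. -/
def components (G : Graph α β) : Set (Graph α β) :=
  {H | ∃ x ∈ G.vertexSet, H = G.induce {y | Relation.ReflTransGen G.Adj x y}}

/-- The interior polynomial `I'_G` of a possibly disconnected bipartite graph `G` with at least one
vertex: `(1 - x) ^ (k - 1)` times the product of the interior polynomials of the `k` components. -/
noncomputable def interior' (G : Graph α β) (A : Set α) (o : LinearOrder α) : ℤ[X] :=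
  (1 - X) ^ ((components G).ncard - 1) * ∏ᶠ (H : Graph α β) (_ : H ∈ components G), interior H A o

/-- The set of negative edges of `G` for the sign function `σ`. -/
def negEdges (G : Graph α β) (σ : β → ℤˣ) : Set β :=
  {e | e ∈ G.edgeSet ∧ σ e = -1}

/-- The signed interior polynomial `I⁺_G`. -/
noncomputable def signedInterior (G : Graph α β) (A : Set α) (σ : β → ℤˣ) (o : LinearOrder α) :
    ℤ[X] :=
  ∑ᶠ (S : Set β) (_ : S ⊆ negEdges G σ), (-1) ^ S.ncard * interior' (G.deleteEdges S) A o

end InteriorPoly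

/-! The heart of the matter is that the interior polynomial does not depend on the order of the
hyperedges. Let `B` be the set of hypertrees, and let g be an integer vector below some member of
`B`. For any order, exactly one f in `B` lies above g and agrees with g on the elements inactive for
f (`exists_eq_on_inactive`, `eq_of_eq_on_inactive`). So the vectors below `B` are partitioned into
cones, f having a free direction for each active element, and counting by coordinate sum expresses
the order-free generating function as the sum over f of (1 - X)^(-active). Multiplying by (1 -
X)^|E| gives the activity polynomial at 1 - X. The exchange property this needs comes from exchange
of spanning trees.

For a connected block sum, spanning trees are unions of spanning trees of the two sides, so
hypertrees correspond to pairs of hypertrees. By order independence v may be taken as the smallest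
element. Then v is never inactive, and any unit sent from one side into the other can stop at v
instead, so inactivity is decided on each side separately (`mem_internallyInactive_iff`).

In general only the two components through v merge, so the exponents k - 1 add. Deleting negative
edges commutes with the block sum, so the signed sum factors as well. -/

namespace InteriorPoly

/-! ### Order independence of activity polynomials for vector sets with exchange -/

section Exchange

variable {α : Type*}

open Classical in
theorem transfer_apply (f : α → ℤ) (x y z : α) :
    transfer f x y z = f z - (if z = x then 1 else 0) + (if z = y then 1 else 0) := by
  simp [transfer, Pi.single_apply]

/-- The base exchange property of a set of integer vectors. -/
def HasExchange (B : Set (α → ℤ)) : Prop :=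
  ∀ f ∈ B, ∀ g ∈ B, ∀ x, g x < f x → ∃ y, f y < g y ∧ transfer f x y ∈ B

/-- The elements of `E` that are internally inactive with respect to `f` in the set `B`. -/
def inactive (B : Set (α → ℤ)) (E : Set α) (o : LinearOrder α) (f : α → ℤ) : Set α :=
  {x | x ∈ E ∧ ∃ y ∈ E, o.lt y x ∧ transfer f x y ∈ B}

/-- The generating function of the elements of `B` by the number of inactive elements. -/
noncomputable def activityPoly (B : Set (α → ℤ)) (E : Set α) (o : LinearOrder α) : ℤ[X] :=
  ∑ᶠ (f : α → ℤ) (_ : f ∈ B), X ^ (inactive B E o f).ncard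

variable {B : Set (α → ℤ)} {E : Finset α} (o : LinearOrder α)

/-- Among the members of `B` above g, one minimises the sum of values weighted by rank. A surplus
over g at an inactive element could be moved to a smaller one, staying above g and lowering the
weight. -/
theorem exists_eq_on_inactive (hB : B.Finite) {g f₀ : α → ℤ} (hf₀ : f₀ ∈ B) (hg : g ≤ f₀) :
    ∃ f ∈ B, g ≤ f ∧ ∀ x ∈ inactive B E o f, f x = g x := by
  classical
  -- The rank of x: the number of smaller elements of `E`.
  let r : α → ℤ := fun x => ((E.filter (fun z => o.lt z x)).card : ℤ)
  obtain ⟨f, ⟨hfB, hgf⟩, hmin⟩ := Set.exists_min_image {f ∈ B | g ≤ f}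
    (fun f => ∑ x ∈ E, f x * r x) (hB.subset fun _ h => h.1) ⟨f₀, hf₀, hg⟩
  refine ⟨f, hfB, hgf, ?_⟩
  rintro x ⟨hxE, y, hyE, hyx, hT⟩
  by_contra hne
  have hlt : g x < f x := lt_of_le_of_ne (hgf x) (Ne.symm hne)
  have hle : g ≤ transfer f x y := by
    intro z
    rw [transfer_apply]
    have := hgf z
    split_ifs with h1 h2 h2
    · linarith
    · subst h1; linarith
    · linarith
    · linarith
  have h := hmin _ ⟨hT, hle⟩
  have hr : r y < r x := by
    simp only [r]
    norm_cast
    refine Finset.card_lt_card ⟨fun z hz => ?_, fun hsub => ?_⟩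
    · simp only [Finset.mem_filter] at hz ⊢
      exact ⟨hz.1, lt_trans hz.2 hyx⟩
    · have := hsub (Finset.mem_filter.2 ⟨hyE, hyx⟩)
      exact lt_irrefl _ (Finset.mem_filter.1 this).2
  have : ∑ z ∈ E, transfer f x y z * r z = ∑ z ∈ E, f z * r z - r x + r y := by
    simp only [transfer_apply, add_mul, sub_mul, ite_mul, one_mul, zero_mul,
      Finset.sum_add_distrib, Finset.sum_sub_distrib]
    simp only [Finset.sum_ite_eq']
    rw [if_pos (Finset.mem_coe.1 hxE), if_pos (Finset.mem_coe.1 hyE)]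
  simp only [this] at h
  linarith

/-- At the largest x where the vectors differ, exchange moves a unit from the larger vector to some
y, necessarily smaller than x. So x is inactive there and the larger value equals g x, although the
other vector is also at least g x. -/
theorem eq_of_eq_on_inactive (hex : HasExchange B) (hsupp : ∀ f ∈ B, ∀ x ∉ E, f x = 0)
    {g f f' : α → ℤ} (hf : f ∈ B) (hf' : f' ∈ B) (hgf : g ≤ f) (hgf' : g ≤ f')
    (h : ∀ x ∈ inactive B E o f, f x = g x) (h' : ∀ x ∈ inactive B E o f', f' x = g x) :
    f = f' := by
  classical
  by_contra hne
  obtain ⟨x₀, hx₀⟩ := Function.ne_iff.1 hne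
  have hE : ∀ z, f z ≠ f' z → z ∈ E := fun z hz => by
    by_contra hzE
    exact hz ((hsupp f hf z hzE).trans (hsupp f' hf' z hzE).symm)
  obtain ⟨x, hx, hmax⟩ : ∃ x, f x ≠ f' x ∧ ∀ y, f y ≠ f' y → o.le y x := by
    obtain ⟨x, hx, hmax⟩ := Finset.exists_max_image (E.filter fun z => f z ≠ f' z) id
      ⟨x₀, Finset.mem_filter.2 ⟨hE _ hx₀, hx₀⟩⟩
    exact ⟨x, (Finset.mem_filter.1 hx).2,
      fun y hy => hmax y (Finset.mem_filter.2 ⟨hE _ hy, hy⟩)⟩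
  have key : ∀ f f' : α → ℤ, f ∈ B → f' ∈ B → g ≤ f' → (∀ x ∈ inactive B E o f, f x = g x) →
      (∀ z, f z ≠ f' z → z ∈ E) → (∀ y, f y ≠ f' y → o.le y x) → f' x < f x → False := by
    intro f f' hf hf' hgf' h hE hmax hlt
    obtain ⟨y, hy, hT⟩ := hex f hf f' hf' x hlt
    have hyx : o.lt y x := by
      refine lt_of_le_of_ne (hmax y hy.ne) ?_
      rintro rfl
      exact absurd hlt hy.not_gt
    exact absurd (hgf' x) (not_le.2 (h x ⟨hE x hlt.ne', y, hE y hy.ne, hyx, hT⟩ ▸ hlt))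
  rcases lt_or_gt_of_ne hx with hlt | hlt
  · exact key f' f hf' hf hgf h' (fun z hz => hE z hz.symm) (fun y hy => hmax y hy.symm) hlt
  · exact key f f' hf hf' hgf' h hE hmax hlt

open Classical in
/-- The elements of `E` that are not inactive with respect to `f`. -/
noncomputable def activeFinset (B : Set (α → ℤ)) (E : Finset α) (o : LinearOrder α) (f : α → ℤ) :
    Finset α :=
  E.filter (· ∉ inactive B E o f)

theorem card_activeFinset_add (f : α → ℤ) :
    (activeFinset B E o f).card + (inactive B E o f).ncard = E.card := by
  classical
  have : inactive B E o f = (E.filter (· ∈ inactive B E o f) : Finset α) := by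
    ext x
    simp only [Finset.coe_filter, Set.mem_ofPred_eq]
    exact ⟨fun h => ⟨h.1, h⟩, fun h => h.2⟩
  rw [this, Set.ncard_coe_finset, activeFinset, add_comm]
  convert Finset.card_filter_add_card_filter_not (s := E) (· ∈ inactive B E o f) using 2

-- Every g on the right is f - c for exactly one f in `B` and one c ≥ 0 of total t supported on the
-- active elements of f. The right side does not involve the order.
open Classical in
theorem sum_card_finsuppAntidiag (hB : B.Finite) (hex : HasExchange B)
    (hsupp : ∀ f ∈ B, ∀ x ∉ E, f x = 0) {s : ℤ} (hsum : ∀ f ∈ B, ∑ x ∈ E, f x = s) (t : ℕ) :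
    ∑ f ∈ hB.toFinset, (Finset.finsuppAntidiag (activeFinset B E o f) t).card =
      {g : α → ℤ | (∀ x ∉ E, g x = 0) ∧ ∑ x ∈ E, g x = s - t ∧ ∃ f ∈ B, g ≤ f}.ncard := by
  rw [← Finset.card_sigma, ← Set.ncard_coe_finset]
  have hact : ∀ (f : α → ℤ) (c : α →₀ ℕ), c.support ⊆ activeFinset B E o f →
      ∀ x ∈ inactive B E o f, c x = 0 := fun f c hc x hx => by
    by_contra hne
    exact (Finset.mem_filter.1 (hc (Finsupp.mem_support_iff.2 hne))).2 hx
  have hin : ∀ (f : α → ℤ) (c : α →₀ ℕ), c.support ⊆ activeFinset B E o f →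
      ∀ x ∉ E, c x = 0 := fun f c hc x hx => by
    by_contra hne
    exact hx (Finset.mem_filter.1 (hc (Finsupp.mem_support_iff.2 hne))).1
  refine Set.ncard_congr (fun p _ => fun x => p.1 x - (p.2 x : ℤ)) ?_ ?_ ?_
  · rintro ⟨f, c⟩ h
    simp only [Finset.coe_sigma, Set.mem_sigma_iff, Finset.mem_coe, Set.Finite.mem_toFinset,
      Finset.mem_finsuppAntidiag] at h
    obtain ⟨hf, hc, hcs⟩ := h
    refine ⟨fun x hx => ?_, ?_, f, hf, fun x => by simp⟩
    · simp [hsupp f hf x hx, hin f c hcs x hx]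
    · rw [Finset.sum_sub_distrib, hsum f hf, ← hc]
      push_cast
      congr 1
      refine (Finset.sum_subset (Finset.filter_subset _ _) fun x _ hx => ?_).symm
      by_contra hne
      exact hx (hcs (Finsupp.mem_support_iff.2 (by exact_mod_cast hne)))
  · rintro ⟨f, c⟩ ⟨f', c'⟩ h h' heq
    simp only [Finset.coe_sigma, Set.mem_sigma_iff, Finset.mem_coe, Set.Finite.mem_toFinset,
      Finset.mem_finsuppAntidiag] at h h'
    obtain ⟨hf, -, hcs⟩ := h
    obtain ⟨hf', -, hcs'⟩ := h'
    have hpt : ∀ x, f x - (c x : ℤ) = f' x - (c' x : ℤ) := fun x => congrFun heq x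
    obtain rfl : f = f' := by
      refine eq_of_eq_on_inactive o hex hsupp (g := fun x => f x - (c x : ℤ)) hf hf'
        (fun x => by simp) (fun x => by simp [hpt x]) (fun x hx => ?_) (fun x hx => ?_)
      · simp [hact f c hcs x hx]
      · simp [hpt x, hact f' c' hcs' x hx]
    obtain rfl : c = c' := by
      ext x
      have := hpt x
      omega
    rfl
  · rintro g ⟨hg0, hgs, f₀, hf₀, hgf₀⟩
    obtain ⟨f, hf, hgf, hin⟩ := exists_eq_on_inactive (E := E) o hB hf₀ hgf₀
    have hsub : ∀ x, (f x - g x).toNat ≠ 0 → x ∈ activeFinset B E o f := fun x hx => by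
      refine Finset.mem_filter.2 ⟨?_, fun hxi => hx (by simp [hin x hxi])⟩
      by_contra hxE
      exact hx (by simp [hsupp f hf x hxE, hg0 x hxE])
    refine ⟨⟨f, Finsupp.onFinset _ (fun x => (f x - g x).toNat) hsub⟩, ?_, ?_⟩
    · simp only [Finset.coe_sigma, Set.mem_sigma_iff, Finset.mem_coe, Set.Finite.mem_toFinset,
        Finset.mem_finsuppAntidiag]
      refine ⟨hf, ?_, Finsupp.support_onFinset_subset⟩
      zify
      have h1 : ∑ x ∈ activeFinset B E o f, (((f x - g x).toNat : ℕ) : ℤ) = ∑ x ∈ E, (f x - g x) := by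
        refine (Finset.sum_subset (Finset.filter_subset _ _) (fun x _ hx => ?_)).trans ?_
        rotate_left
        · exact Finset.sum_congr rfl fun x _ => Int.toNat_of_nonneg (sub_nonneg.2 (hgf x))
        · by_contra hne
          exact hx (hsub x (by exact_mod_cast hne))
      refine Eq.trans (Finset.sum_congr rfl fun _ _ => rfl) (h1.trans ?_)
      rw [ Finset.sum_sub_distrib, hsum f hf, hgs]
      ring
    · funext x
      simp only [Finsupp.onFinset_apply]
      rw [Int.toNat_of_nonneg (sub_nonneg.2 (hgf x))]
      ring

/-- `PowerSeries.mk 1` is 1/(1 - X); the coefficient of X^t in its n-th power counts the ways to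
distribute t units over n elements. -/
theorem sum_pow_card_activeFinset (hB : B.Finite) (hex : HasExchange B)
    (hsupp : ∀ f ∈ B, ∀ x ∉ E, f x = 0) {s : ℤ} (hsum : ∀ f ∈ B, ∑ x ∈ E, f x = s) :
    ∑ f ∈ hB.toFinset, (PowerSeries.mk 1 : PowerSeries ℤ) ^ (activeFinset B E o f).card =
      PowerSeries.mk fun t => (({g : α → ℤ | (∀ x ∉ E, g x = 0) ∧ ∑ x ∈ E, g x = s - t ∧
        ∃ f ∈ B, g ≤ f}.ncard : ℕ) : ℤ) := by
  classical
  ext t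
  rw [PowerSeries.coeff_mk, ← sum_card_finsuppAntidiag o hB hex hsupp hsum, map_sum]
  push_cast
  refine Finset.sum_congr rfl fun f _ => ?_
  rw [← Finset.prod_const, PowerSeries.coeff_prod]
  simp

/-- The activity polynomial of a set of vectors with the exchange property does not depend on the
order. -/
theorem activityPoly_eq_of_hasExchange (hB : B.Finite) (hex : HasExchange B)
    (hsupp : ∀ f ∈ B, ∀ x ∉ E, f x = 0) {s : ℤ} (hsum : ∀ f ∈ B, ∑ x ∈ E, f x = s)
    (o o' : LinearOrder α) : activityPoly B E o = activityPoly B E o' := by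
  -- Substituting 1 - X turns X^inactive into (1 - X)^inactive, which is (1 - X)^|E| times (1 -
  -- X)^(-active).
  have hP : ∀ o : LinearOrder α,
      (((activityPoly B E o).comp (1 - X) : ℤ[X]) : PowerSeries ℤ) = (1 - PowerSeries.X) ^ E.card *
        ∑ f ∈ hB.toFinset, (PowerSeries.mk 1 : PowerSeries ℤ) ^ (activeFinset B E o f).card := by
    intro o
    rw [activityPoly, finsum_mem_eq_finite_toFinset_sum _ hB, Polynomial.sum_comp,
      ← Polynomial.coeToPowerSeries.ringHom_apply, map_sum, Finset.mul_sum]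
    refine Finset.sum_congr rfl fun f _ => ?_
    rw [← card_activeFinset_add (B := B) o f, pow_add, mul_right_comm, ← mul_pow, mul_comm (1 - _),
      PowerSeries.mk_one_mul_one_sub_eq_one]
    simp
  have h : (activityPoly B E o).comp (1 - X) = (activityPoly B E o').comp (1 - X) := by
    rw [← Polynomial.coe_inj, hP, hP, sum_pow_card_activeFinset o hB hex hsupp hsum,
      sum_pow_card_activeFinset o' hB hex hsupp hsum]
  -- The substitution of 1 - X is an involution.
  have := congrArg (fun P : ℤ[X] => P.comp (1 - X)) h
  simpa [Polynomial.comp_assoc] using this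

end Exchange

/-! ### Spanning trees as edge sets, and their exchange property -/

section SpanningTree

variable {α β : Type*} {G : Graph α β} {A : Set α} {F F' K : Set β} {a b x y : α} {e : β}

open Relation

theorem reflTransGen_adj_symm (h : ReflTransGen G.Adj a b) : ReflTransGen G.Adj b a :=
  (ReflTransGen.stdSymm (r := G.Adj)).symm _ _ h

theorem mem_of_reflTransGen_adj (ha : a ∈ V(G)) (h : ReflTransGen G.Adj a b) : b ∈ V(G) := by
  induction h with
  | refl => exact ha
  | tail _ h _ => exact h.right_mem

/-- Any two vertices of `G` are joined by a path. -/
def IsPreconnected (G : Graph α β) : Prop :=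
  ∀ a ∈ V(G), ∀ b ∈ V(G), ReflTransGen G.Adj a b

theorem toSimpleGraph_connected (hG : IsPreconnected G) (hV : V(G).Nonempty) :
    G.toSimpleGraph.Connected := by
  have key : ∀ a b (ha : a ∈ V(G)) (hb : b ∈ V(G)), ReflTransGen G.Adj a b →
      G.toSimpleGraph.Reachable ⟨a, ha⟩ ⟨b, hb⟩ := by
    intro a b ha hb h
    induction h with
    | refl => exact SimpleGraph.Reachable.refl _
    | @tail c d hc hcd ih =>
      refine (ih hcd.left_mem).trans ?_
      by_cases hne : c = d
      · subst hne; exact SimpleGraph.Reachable.refl _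
      · exact SimpleGraph.Adj.reachable ⟨fun h => hne (congrArg Subtype.val h), hcd⟩
  have := hV.to_subtype
  exact ⟨fun a b => key _ _ a.2 b.2 (hG a a.2 b b.2)⟩

theorem isPreconnected_of_toSimpleGraph (h : G.toSimpleGraph.Connected) : IsPreconnected G := by
  intro a ha b hb
  have h' := (SimpleGraph.reachable_iff_reflTransGen _ _).1 (h.preconnected ⟨a, ha⟩ ⟨b, hb⟩)
  exact h'.lift Subtype.val fun _ _ h => h.2

/-- Choosing one edge per adjacent pair makes edge counts of simple graphs available for
multigraphs. -/
theorem exists_edge_map (G : Graph α β) : ∃ φ : G.toSimpleGraph.edgeSet → E(G),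
    Function.Injective φ ∧ ∀ (s : G.toSimpleGraph.edgeSet) (x y : V(G)),
      s.1 = s(x, y) → G.IsLink (φ s) x y := by
  have : ∀ s : G.toSimpleGraph.edgeSet, ∃ e : E(G), ∀ x y : V(G), s.1 = s(x, y) →
      G.IsLink e x y := by
    rintro ⟨s, hs⟩
    induction s with
    | h u v =>
      obtain ⟨-, e, he⟩ := (SimpleGraph.mem_edgeSet _).1 hs
      refine ⟨⟨e, he.edge_mem⟩, fun x y hxy => ?_⟩
      rcases Sym2.eq_iff.1 hxy with ⟨rfl, rfl⟩ | ⟨rfl, rfl⟩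
      · exact he
      · exact he.symm
  choose φ hφ using this
  refine ⟨φ, ?_, hφ⟩
  rintro ⟨s, hs⟩ ⟨t, ht⟩ hst
  induction s with
  | h u v =>
    induction t with
    | h u' v' =>
      have h1 := hφ ⟨_, hs⟩ u v rfl
      have h2 := hφ ⟨_, ht⟩ u' v' rfl
      rw [hst] at h1
      refine Subtype.ext (Sym2.eq_iff.2 ?_)
      rcases h1.eq_and_eq_or_eq_and_eq h2 with ⟨p, q⟩ | ⟨p, q⟩
      · exact Or.inl ⟨Subtype.ext p, Subtype.ext q⟩
      · exact Or.inr ⟨Subtype.ext p, Subtype.ext q⟩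

theorem ncard_vertexSet_le (hE : E(G).Finite) (hG : IsPreconnected G) :
    V(G).ncard ≤ E(G).ncard + 1 := by
  rcases V(G).eq_empty_or_nonempty with h | h
  · simp [h]
  obtain ⟨φ, hφ, -⟩ := exists_edge_map G
  have := hE.to_subtype
  have := (toSimpleGraph_connected hG h).card_vert_le_card_edgeSet_add_one
  have := Nat.card_le_card_of_injective φ hφ
  simp only [Nat.card_coe_set_eq] at *
  omega

/-- A connected graph with one edge fewer than vertices leaves no room for edges outside the image
of the map from `exists_edge_map`; its surjectivity excludes loops and parallel edges. -/
theorem isTree_iff (hV : V(G).Finite) (hE : E(G).Finite) :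
    IsTree G ↔ IsPreconnected G ∧ E(G).ncard + 1 = V(G).ncard := by
  obtain ⟨φ, hφ, hlink⟩ := exists_edge_map G
  have := hE.to_subtype
  have := hV.to_subtype
  have : Finite G.toSimpleGraph.edgeSet := Finite.of_injective φ hφ
  constructor
  · rintro ⟨hs, ht⟩
    refine ⟨isPreconnected_of_toSimpleGraph ht.connected, ?_⟩
    have hsurj : Function.Surjective φ := by
      rintro ⟨e, he⟩
      obtain ⟨x, y, hxy⟩ := Graph.exists_isLink_of_mem_edgeSet he
      have hadj : s((⟨x, hxy.left_mem⟩ : V(G)), ⟨y, hxy.right_mem⟩) ∈ G.toSimpleGraph.edgeSet :=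
        ⟨fun h => hxy.ne (congrArg Subtype.val h), e, hxy⟩
      exact ⟨⟨_, hadj⟩, Subtype.ext ((hlink ⟨_, hadj⟩ _ _ rfl).eq hxy)⟩
    have h1 := Nat.card_eq_of_bijective φ ⟨hφ, hsurj⟩
    have h2 := (SimpleGraph.isTree_iff_connected_and_card.1 ht).2
    simp only [Nat.card_coe_set_eq] at h1 h2
    omega
  · rintro ⟨hconn, hcard⟩
    have hne : V(G).Nonempty := (Set.ncard_pos hV).1 (by omega)
    have hc := toSimpleGraph_connected hconn hne
    have h1 := hc.card_vert_le_card_edgeSet_add_one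
    have h2 := Nat.card_le_card_of_injective φ hφ
    have hbij : Function.Bijective φ := by
      refine (Nat.bijective_iff_injective_and_card φ).2 ⟨hφ, ?_⟩
      simp only [Nat.card_coe_set_eq] at *
      omega
    have hl : G.Loopless := by
      refine ⟨fun e x h => ?_⟩
      obtain ⟨⟨s, hs⟩, hse⟩ := hbij.2 ⟨e, h.edge_mem⟩
      induction s with
      | h u v =>
        have := hlink ⟨_, hs⟩ u v rfl
        rw [hse] at this
        refine ((SimpleGraph.mem_edgeSet _).1 hs).1 (Subtype.ext ?_)
        exact (h.eq_of_inc this.inc_left).symm.trans (h.eq_of_inc this.inc_right)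
    refine ⟨{ eq_of_isLink := fun e f x y he hf => ?_ },
      SimpleGraph.isTree_iff_connected_and_card.2 ⟨hc, ?_⟩⟩
    · have key : ∀ e (he : G.IsLink e x y) s, φ s = ⟨e, he.edge_mem⟩ →
          s.1 = s((⟨x, he.left_mem⟩ : V(G)), ⟨y, he.right_mem⟩) := by
        rintro e he ⟨s, hs⟩ hse
        induction s with
        | h u v =>
          have := hlink ⟨_, hs⟩ u v rfl
          rw [hse] at this
          refine Sym2.eq_iff.2 ?_
          rcases this.eq_and_eq_or_eq_and_eq he with ⟨p, q⟩ | ⟨p, q⟩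
          · exact Or.inl ⟨Subtype.ext p, Subtype.ext q⟩
          · exact Or.inr ⟨Subtype.ext p, Subtype.ext q⟩
      obtain ⟨s, hs⟩ := hbij.2 ⟨e, he.edge_mem⟩
      obtain ⟨t, ht⟩ := hbij.2 ⟨f, hf.edge_mem⟩
      have hst : s = t := Subtype.ext ((key e he s hs).trans (key f hf t ht).symm)
      subst hst
      exact congrArg Subtype.val (hs.symm.trans ht)
    · have := Nat.card_eq_of_bijective φ hbij
      simp only [Nat.card_coe_set_eq] at *
      omega

/-- The edges in `F` form a spanning tree of `G`. -/
def IsSpanningTree (G : Graph α β) (F : Set β) : Prop :=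
  F ⊆ E(G) ∧ IsPreconnected (G.restrict F) ∧ F.ncard + 1 = V(G).ncard

/-- The degree vector of an edge set `F` on the hyperedges, lowered by one. -/
noncomputable def degreeVector (G : Graph α β) (A : Set α) (F : Set β) : α → ℤ :=
  open Classical in
  fun x => if x ∈ V(G) ∩ A then ({e ∈ F | G.Inc e x}.ncard : ℤ) - 1 else 0

theorem isHypertree_iff (hV : V(G).Finite) (hE : E(G).Finite) {f : α → ℤ} :
    IsHypertree G A f ↔ ∃ F, IsSpanningTree G F ∧ degreeVector G A F = f := by
  constructor
  · rintro ⟨h0, T, hTG, hT, hdeg⟩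
    have hVT : V(T) = V(G) := hTG.vertexSet_eq
    have hET : E(T) ⊆ E(G) := hTG.le.edgeSet_mono
    have hres : G.restrict E(T) = T := by
      refine Graph.ext hVT.symm fun e x y => ⟨fun h => ?_, fun h => ?_⟩
      · obtain ⟨u, v, huv⟩ := Graph.exists_isLink_of_mem_edgeSet h.1
        rcases h.2.eq_and_eq_or_eq_and_eq (huv.mono hTG.le) with ⟨rfl, rfl⟩ | ⟨rfl, rfl⟩
        · exact huv
        · exact huv.symm
      · exact ⟨h.edge_mem, h.mono hTG.le⟩
    obtain ⟨hc, hcard⟩ := (isTree_iff (hVT ▸ hV) (hE.subset hET)).1 hT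
    refine ⟨E(T), ⟨hET, hres.symm ▸ hc, hVT ▸ hcard⟩, funext fun x => ?_⟩
    rw [degreeVector]
    split_ifs with hx
    · rw [sub_eq_iff_eq_add, ← hdeg x hx, degree]
      congr 2
      ext e
      conv_rhs => rw [← hres]
      simp [and_comm]
    · exact (h0 x hx).symm
  · rintro ⟨F, ⟨hFE, hc, hcard⟩, rfl⟩
    have hEF : E(G.restrict F) = F := by simpa using hFE
    refine ⟨fun x hx => by simp only [degreeVector]; rw [if_neg hx], G.restrict F,
      ⟨Graph.restrict_le, rfl⟩, (isTree_iff (G := G.restrict F) hV (hEF.symm ▸ hE.subset hFE)).2 ⟨hc, ?_⟩, fun x hx => ?_⟩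
    · rw [hEF]; exact hcard
    · simp only [degreeVector]
      rw [if_pos hx, sub_add_cancel, degree]
      congr 2
      ext e
      simp [and_comm]

theorem IsSpanningTree.finite (hE : E(G).Finite) (hF : IsSpanningTree G F) : F.Finite :=
  hE.subset hF.1

theorem reflTransGen_restrict_mono (h : K ⊆ F) (hab : ReflTransGen (G.restrict K).Adj a b) :
    ReflTransGen (G.restrict F).Adj a b :=
  ReflTransGen.mono (fun _ _ ⟨e, he⟩ => ⟨e, h he.1, he.2⟩) _ _ hab

theorem reflTransGen_of_subset_insert (hF : F ⊆ insert e K) (he : G.IsLink e x y)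
    (hxy : ReflTransGen (G.restrict K).Adj x y) (hab : ReflTransGen (G.restrict F).Adj a b) :
    ReflTransGen (G.restrict K).Adj a b := by
  induction hab with
  | refl => exact .refl
  | @tail c d _ hcd ih =>
    refine ih.trans ?_
    obtain ⟨f, hf, hlink⟩ := hcd
    rcases hF hf with rfl | hfK
    · rcases hlink.eq_and_eq_or_eq_and_eq he with ⟨rfl, rfl⟩ | ⟨rfl, rfl⟩
      · exact hxy
      · exact reflTransGen_adj_symm hxy
    · exact .single ⟨f, hfK, hlink⟩

theorem reflTransGen_or_of_subset_insert (hF : F ⊆ insert e K) (he : G.IsLink e x y)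
    (hab : ReflTransGen (G.restrict F).Adj x b) :
    ReflTransGen (G.restrict K).Adj x b ∨ ReflTransGen (G.restrict K).Adj y b := by
  induction hab with
  | refl => exact .inl .refl
  | @tail c d _ hcd ih =>
    obtain ⟨f, hf, hlink⟩ := hcd
    rcases hF hf with rfl | hfK
    · rcases hlink.eq_and_eq_or_eq_and_eq he with ⟨rfl, rfl⟩ | ⟨rfl, rfl⟩
      · exact .inr .refl
      · exact .inl .refl
    · exact ih.imp (fun h => h.tail ⟨f, hfK, hlink⟩) (fun h => h.tail ⟨f, hfK, hlink⟩)

theorem exists_exit {r : α → α → Prop} {S : α → Prop} (h : ReflTransGen r a b) (ha : S a)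
    (hb : ¬ S b) : ∃ c d, r c d ∧ S c ∧ ¬ S d := by
  induction h with
  | refl => exact absurd ha hb
  | @tail c d _ hcd ih =>
    by_cases hc : S c
    · exact ⟨c, d, hcd, hc, hb⟩
    · exact ih hc

theorem ncard_vertexSet_le_of_restrict (hF : F ⊆ E(G)) (hfin : F.Finite)
    (hc : IsPreconnected (G.restrict F)) : V(G).ncard ≤ F.ncard + 1 := by
  have hEF : E(G.restrict F) = F := by simpa using hF
  have := ncard_vertexSet_le (G := G.restrict F) (hEF.symm ▸ hfin) hc
  rwa [hEF] at this

/-- The base exchange property of spanning trees. -/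
theorem IsSpanningTree.exists_exchange (hE : E(G).Finite) (hF : IsSpanningTree G F)
    (hF' : IsSpanningTree G F') (heF : e ∈ F) (heF' : e ∉ F') :
    ∃ e₁ ∈ F', e₁ ∉ F ∧ IsSpanningTree G (insert e₁ (F \ {e})) := by
  obtain ⟨x, y, hxy⟩ := Graph.exists_isLink_of_mem_edgeSet (hF.1 heF)
  have hfin := hF.finite hE
  have hcard : (F \ {e}).ncard + 1 = F.ncard := Set.ncard_sdiff_singleton_add_one heF hfin
  have hsub : F ⊆ insert e (F \ {e}) := fun f hf => by
    by_cases h : f = e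
    · exact .inl h
    · exact .inr ⟨hf, h⟩
  -- Otherwise `F \ {e}` would connect all vertices with too few edges.
  have hnot : ¬ ReflTransGen (G.restrict (F \ {e})).Adj x y := fun h => by
    have := ncard_vertexSet_le_of_restrict (Set.sdiff_subset.trans hF.1) (hfin.subset Set.sdiff_subset)
      (fun a ha b hb => reflTransGen_of_subset_insert hsub hxy h (hF.2.1 a ha b hb))
    have := hF.2.2
    omega
  -- The walk from x to y in `F'` must leave the part of `F \ {e}` around x; `e₁` is the edge by
  -- which it leaves.
  obtain ⟨c, d, ⟨e₁, he₁F', hcd⟩, hc, hd⟩ := exists_exit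
    (S := fun z => ReflTransGen (G.restrict (F \ {e})).Adj x z)
    (hF'.2.1 x hxy.left_mem y hxy.right_mem) .refl hnot
  have he₁F : e₁ ∉ F := fun h =>
    hd (hc.tail ⟨e₁, ⟨h, fun h' => heF' (Set.mem_singleton_iff.1 h' ▸ he₁F')⟩, hcd⟩)
  refine ⟨e₁, he₁F', he₁F, Set.insert_subset (hF'.1 he₁F') (Set.sdiff_subset.trans hF.1), ?_, ?_⟩
  · have hmono : F \ {e} ⊆ insert e₁ (F \ {e}) := Set.subset_insert _ _
    have hyd : ReflTransGen (G.restrict (F \ {e})).Adj y d :=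
      (reflTransGen_or_of_subset_insert hsub hxy
        (hF.2.1 x hxy.left_mem d hcd.right_mem)).resolve_left hd
    have hxy' : ReflTransGen (G.restrict (insert e₁ (F \ {e}))).Adj x y :=
      ((reflTransGen_restrict_mono hmono hc).tail ⟨e₁, Set.mem_insert _ _, hcd⟩).trans
        (reflTransGen_adj_symm (reflTransGen_restrict_mono hmono hyd))
    exact fun a ha b hb => reflTransGen_of_subset_insert
      (hsub.trans (Set.insert_subset_insert hmono)) hxy hxy' (hF.2.1 a ha b hb)
  · rw [Set.ncard_insert_of_notMem (fun h => he₁F h.1) (hfin.subset Set.sdiff_subset), hcard]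
    exact hF.2.2

end SpanningTree

/-! ### Exchange for hypertrees -/

section Hypertree

variable {α β : Type*} {G : Graph α β} {A : Set α} {F F' K : Set β} {x y z : α} {e : β}

theorem IsBipartition.exists_hyperedge (hA : IsBipartition G A) (he : e ∈ E(G)) :
    ∃ x ∈ A, G.Inc e x := by
  obtain ⟨x, y, hxy⟩ := Graph.exists_isLink_of_mem_edgeSet he
  by_cases hx : x ∈ A
  · exact ⟨x, hx, hxy.inc_left⟩
  · exact ⟨y, not_not.1 fun hy => hx ((hA hxy).2 hy), hxy.inc_right⟩

theorem IsBipartition.eq_of_inc (hA : IsBipartition G A) (hx : x ∈ A) (hy : y ∈ A)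
    (hex : G.Inc e x) (hey : G.Inc e y) : y = x := by
  obtain ⟨z, hz⟩ := hex
  rcases hey.eq_or_eq_of_isLink hz with h | rfl
  · exact h
  · exact absurd hy ((hA hz).1 hx)

theorem degreeVector_of_mem (hx : x ∈ V(G) ∩ A) :
    degreeVector G A F x = ({e ∈ F | G.Inc e x}.ncard : ℤ) - 1 := if_pos hx

theorem degreeVector_of_notMem (hx : x ∉ V(G) ∩ A) : degreeVector G A F x = 0 := if_neg hx

-- An edge has exactly one end in `A`, so adding it raises a single coordinate.
open Classical in
theorem degreeVector_insert (hA : IsBipartition G A) (hK : K.Finite) (he : e ∉ K) (hx : x ∈ A)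
    (hex : G.Inc e x) (z : α) :
    degreeVector G A (insert e K) z = degreeVector G A K z + if z = x then 1 else 0 := by
  by_cases hz : z ∈ V(G) ∩ A
  · rw [degreeVector_of_mem hz, degreeVector_of_mem hz]
    split_ifs with h
    · subst h
      have : {f ∈ insert e K | G.Inc f z} = insert e {f ∈ K | G.Inc f z} := by
        ext f
        constructor
        · rintro ⟨rfl | h, h'⟩
          · exact .inl rfl
          · exact .inr ⟨h, h'⟩
        · rintro (rfl | h)
          · exact ⟨.inl rfl, hex⟩
          · exact ⟨.inr h.1, h.2⟩
      rw [this, Set.ncard_insert_of_notMem (fun h => he h.1) (hK.subset fun _ h => h.1)]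
      push_cast
      ring
    · have : {f ∈ insert e K | G.Inc f z} = {f ∈ K | G.Inc f z} := by
        ext f
        constructor
        · rintro ⟨rfl | h, h'⟩
          · exact absurd (hA.eq_of_inc hx hz.2 hex h') h
          · exact ⟨h, h'⟩
        · exact fun h => ⟨.inr h.1, h.2⟩
      rw [this, add_zero]
  · have : z ≠ x := by
      rintro rfl
      exact hz ⟨hex.vertex_mem, hx⟩
    rw [degreeVector_of_notMem hz, degreeVector_of_notMem hz, if_neg this, add_zero]

theorem degreeVector_swap (hA : IsBipartition G A) (hF : F.Finite) (he : e ∈ F) {e₁ : β}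
    (he₁ : e₁ ∉ F) (hx : x ∈ A) (hex : G.Inc e x) (hy : y ∈ A) (hey : G.Inc e₁ y) :
    degreeVector G A (insert e₁ (F \ {e})) = transfer (degreeVector G A F) x y := by
  classical
  funext z
  have hfin : (F \ {e}).Finite := hF.subset Set.sdiff_subset
  have h := degreeVector_insert hA hfin (fun h => h.2 rfl) hx hex z
  rw [Set.insert_sdiff_self_of_mem he] at h
  rw [degreeVector_insert hA hfin (fun h => he₁ h.1) hy hey, transfer_apply, h]
  ring

theorem sum_degreeVector (hA : IsBipartition G A) {E : Finset α} (hE : (E : Set α) = V(G) ∩ A)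
    (hF : F.Finite) (hFG : F ⊆ E(G)) : ∑ x ∈ E, degreeVector G A F x = F.ncard - E.card := by
  classical
  induction F, hF using Set.Finite.induction_on with
  | empty =>
    have : ∀ x ∈ E, degreeVector G A ∅ x = -1 := fun x hx => by
      rw [degreeVector_of_mem (hE ▸ hx)]
      simp
    rw [Finset.sum_congr rfl this]
    simp
  | @insert e K he hK ih =>
    obtain ⟨x, hx, hex⟩ := hA.exists_hyperedge (hFG (Set.mem_insert e K))
    have hxE : x ∈ E := by
      rw [← Finset.mem_coe, hE]
      exact ⟨hex.vertex_mem, hx⟩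
    rw [Finset.sum_congr rfl fun z _ => degreeVector_insert hA hK he hx hex z,
      Finset.sum_add_distrib, ih ((Set.subset_insert _ _).trans hFG), Finset.sum_ite_eq',
      if_pos hxE, Set.ncard_insert_of_notMem he hK]
    push_cast
    ring

theorem exists_mem_of_degreeVector_lt (hF' : F'.Finite)
    (h : degreeVector G A F' x < degreeVector G A F x) :
    x ∈ V(G) ∩ A ∧ ∃ e ∈ F, e ∉ F' ∧ G.Inc e x := by
  have hx : x ∈ V(G) ∩ A := by
    by_contra hx
    rw [degreeVector_of_notMem hx, degreeVector_of_notMem hx] at h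
    exact lt_irrefl _ h
  refine ⟨hx, ?_⟩
  by_contra! hno
  rw [degreeVector_of_mem hx, degreeVector_of_mem hx] at h
  have := Set.ncard_le_ncard (s := {e ∈ F | G.Inc e x}) (t := {e ∈ F' | G.Inc e x})
    (fun e he => ⟨by_contra fun h' => hno e he.1 h' he.2, he.2⟩) (hF'.subset fun _ h => h.1)
  omega

/-- Induction on the distance from `F` to `F'`. A tree exchange trades an edge at x for an edge of
`F'` at some y, which may not be a coordinate where `F` is deficient; the tree is then closer to
`F'`, and the induction continues from it. -/
theorem IsSpanningTree.exists_transfer (hE : E(G).Finite) (hA : IsBipartition G A)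
    (hF' : IsSpanningTree G F') (n : ℕ) : ∀ F, IsSpanningTree G F → (F \ F').ncard = n →
      ∀ x, degreeVector G A F' x < degreeVector G A F x →
        ∃ y, degreeVector G A F y < degreeVector G A F' y ∧
          ∃ K, IsSpanningTree G K ∧ degreeVector G A K = transfer (degreeVector G A F) x y := by
  classical
  induction n using Nat.strong_induction_on with
  | _ n ih =>
    intro F hF hn x hlt
    obtain ⟨hx, e, heF, heF', hex⟩ := exists_mem_of_degreeVector_lt (hF'.finite hE) hlt
    obtain ⟨e₁, he₁F', he₁F, hF₁⟩ := hF.exists_exchange hE hF' heF heF'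
    obtain ⟨y, hy, hey⟩ := hA.exists_hyperedge (hF'.1 he₁F')
    have hvec := degreeVector_swap hA (hF.finite hE) heF he₁F hx.2 hex hy hey
    have hcard : ((insert e₁ (F \ {e})) \ F').ncard < n := by
      rw [← hn]
      refine Set.ncard_lt_ncard ⟨?_, fun h => ?_⟩ ((hF.finite hE).subset Set.sdiff_subset)
      · rintro f ⟨rfl | hf, hf'⟩
        · exact absurd he₁F' hf'
        · exact ⟨hf.1, hf'⟩
      · rcases (h ⟨heF, heF'⟩).1 with h | h
        · exact heF' (h ▸ he₁F')
        · exact h.2 rfl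
    have hval : ∀ z, degreeVector G A (insert e₁ (F \ {e})) z = _ := fun z =>
      (congrFun hvec z).trans (transfer_apply _ _ _ _)
    -- The exchange did not change the vector, only brought the tree closer.
    by_cases hyx : y = x
    · have hself : degreeVector G A (insert e₁ (F \ {e})) = degreeVector G A F := by
        rw [hvec, hyx]
        simp [transfer]
      have := ih _ hcard _ hF₁ rfl x (by rwa [hself])
      rwa [hself] at this
    by_cases hlt' : degreeVector G A F y < degreeVector G A F' y
    · exact ⟨y, hlt', _, hF₁, hvec⟩
    -- The received unit makes y exceed its value for `F'`, so the induction passes it on to some w;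
    -- the moves x to y and y to w compose to x to w.
    obtain ⟨w, hw, K, hK, hKv⟩ := ih _ hcard _ hF₁ rfl y (by
      rw [hval, if_neg hyx, if_pos rfl]
      omega)
    have hwy : w ≠ y := by
      rintro rfl
      rw [hval, if_neg hyx, if_pos rfl] at hw
      omega
    have hwx : w ≠ x := by
      rintro rfl
      rw [hval, if_pos rfl, if_neg hwy] at hw
      omega
    refine ⟨w, ?_, K, hK, ?_⟩
    · rw [hval, if_neg hwx, if_neg hwy] at hw
      omega
    · rw [hKv, hvec]
      simp only [transfer]
      abel

theorem hasExchange_isHypertree (hV : V(G).Finite) (hE : E(G).Finite) (hA : IsBipartition G A) :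
    HasExchange {f | IsHypertree G A f} := by
  intro f hf g hg x hlt
  obtain ⟨F, hF, rfl⟩ := (isHypertree_iff hV hE).1 hf
  obtain ⟨F', hF', rfl⟩ := (isHypertree_iff hV hE).1 hg
  obtain ⟨y, hy, K, hK, hKv⟩ := hF'.exists_transfer hE hA _ F hF rfl x hlt
  exact ⟨y, hy, (isHypertree_iff hV hE).2 ⟨K, hK, hKv⟩⟩

theorem finite_isHypertree (hV : V(G).Finite) (hE : E(G).Finite) :
    {f | IsHypertree G A f}.Finite := by
  refine (hE.finite_subsets.image (degreeVector G A)).subset fun f hf => ?_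
  obtain ⟨F, hF, rfl⟩ := (isHypertree_iff hV hE).1 hf
  exact ⟨F, hF.1, rfl⟩

theorem IsHypertree.sum_eq (hV : V(G).Finite) (hE : E(G).Finite) (hA : IsBipartition G A)
    {E : Finset α} (hEA : (E : Set α) = V(G) ∩ A) {f : α → ℤ} (hf : IsHypertree G A f) :
    ∑ x ∈ E, f x = V(G).ncard - 1 - E.card := by
  obtain ⟨F, hF, rfl⟩ := (isHypertree_iff hV hE).1 hf
  rw [sum_degreeVector hA hEA (hF.finite hE) hF.1, ← hF.2.2]
  push_cast
  ring

/-- The interior polynomial does not depend on the order of the hyperedges. -/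
theorem interior_eq (hV : V(G).Finite) (hE : E(G).Finite) (hA : IsBipartition G A)
    (o o' : LinearOrder α) : interior G A o = interior G A o' := by
  obtain ⟨E, hEA⟩ := (hV.subset (Set.inter_subset_left (t := A))).exists_finset_coe
  have h := activityPoly_eq_of_hasExchange (E := E) (finite_isHypertree (A := A) hV hE)
    (hasExchange_isHypertree hV hE hA) (fun f hf x hx => hf.1 x (by rwa [← hEA, Finset.mem_coe]))
    (fun f hf => IsHypertree.sum_eq hV hE hA hEA hf) o o'
  rw [hEA] at h
  exact h

end Hypertree

/-! ### Block sums of connected graphs -/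

section BlockSum

variable {α β : Type*} {G G₁ G₂ : Graph α β} {A : Set α} {F F₁ F₂ : Set β} {v x y z : α} {e : β}

open Relation

/-- The graphs `G₁` and `G₂` have exactly the vertex `v` and no edge in common. -/
structure MeetAt (G₁ G₂ : Graph α β) (v : α) : Prop where
  inter_eq : V(G₁) ∩ V(G₂) = {v}
  disjoint : Disjoint E(G₁) E(G₂)

/-- Lexicographic order in which the first key singles out v. -/
theorem exists_linearOrder_min (o : LinearOrder α) (v : α) :
    ∃ o' : LinearOrder α, ∀ z, z ≠ v → o'.lt v z := by
  classical
  refine ⟨LinearOrder.lift' (fun a => toLex ((if a = v then 0 else 1 : ℕ), a))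
    (fun a b hab => (Prod.ext_iff.1 (toLex.injective hab)).2), fun z hz => ?_⟩
  change toLex ((if v = v then 0 else 1 : ℕ), v) < toLex ((if z = v then 0 else 1 : ℕ), z)
  rw [Prod.Lex.toLex_lt_toLex]
  simp [hz]

open Classical in
/-- The vector with entry one at `v` if `v` is a hyperedge, and zero otherwise. -/
noncomputable def meetVector (A : Set α) (v : α) : α → ℤ :=
  Pi.single v (if v ∈ A then 1 else 0)

theorem meetVector_of_ne (hz : z ≠ v) : meetVector A v z = 0 := by
  simp [meetVector, hz]

namespace MeetAt

theorem symm (h : MeetAt G₁ G₂ v) : MeetAt G₂ G₁ v :=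
  ⟨by rw [Set.inter_comm, h.inter_eq], h.disjoint.symm⟩

theorem mem_left (h : MeetAt G₁ G₂ v) : v ∈ V(G₁) :=
  (h.inter_eq.symm ▸ Set.mem_singleton v : v ∈ V(G₁) ∩ V(G₂)).1

theorem eq_of_mem (h : MeetAt G₁ G₂ v) (h₁ : z ∈ V(G₁)) (h₂ : z ∈ V(G₂)) : z = v := by
  have : z ∈ V(G₁) ∩ V(G₂) := ⟨h₁, h₂⟩
  rwa [h.inter_eq] at this

theorem isLink_iff (h : MeetAt G₁ G₂ v) :
    (blockSum G₁ G₂).IsLink e x y ↔ G₁.IsLink e x y ∨ G₂.IsLink e x y :=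
  ⟨fun h' => h'.imp id And.right, fun h' => h'.imp id fun hl =>
    ⟨fun he => Set.disjoint_left.1 h.disjoint he hl.edge_mem, hl⟩⟩

theorem inc_iff (h : MeetAt G₁ G₂ v) :
    (blockSum G₁ G₂).Inc e x ↔ G₁.Inc e x ∨ G₂.Inc e x := by
  simp only [Graph.Inc, h.isLink_iff, exists_or]

theorem edgeSet_eq (h : MeetAt G₁ G₂ v) : E(blockSum G₁ G₂) = E(G₁) ∪ E(G₂) := by
  ext e
  simp only [Graph.edge_mem_iff_exists_isLink, h.isLink_iff, exists_or, Set.mem_union]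

theorem blockSum_comm (h : MeetAt G₁ G₂ v) : blockSum G₁ G₂ = blockSum G₂ G₁ :=
  Graph.ext (Set.union_comm _ _) fun e x y => by rw [h.isLink_iff, h.symm.isLink_iff, or_comm]

theorem isBipartition (h : MeetAt G₁ G₂ v) (h₁ : IsBipartition G₁ A) (h₂ : IsBipartition G₂ A) :
    IsBipartition (blockSum G₁ G₂) A := fun _ _ _ hl =>
  (h.isLink_iff.1 hl).elim (fun h => h₁ h) (fun h => h₂ h)

/-- Collapsing `G₂` to v maps walks of the block sum to walks of `G₁`. -/
theorem isPreconnected_left (h : MeetAt G₁ G₂ v) (hF₂ : F₂ ⊆ E(G₂))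
    (hc : IsPreconnected ((blockSum G₁ G₂).restrict (F₁ ∪ F₂))) :
    IsPreconnected (G₁.restrict F₁) := by
  classical
  intro a ha b hb
  let r : α → α := fun z => if z ∈ V(G₁) then z else v
  have hr₁ : ∀ z ∈ V(G₁), r z = z := fun z hz => if_pos hz
  have hr₂ : ∀ z ∈ V(G₂), r z = v := fun z hz => by
    by_cases hz₁ : z ∈ V(G₁)
    · rw [hr₁ z hz₁, h.eq_of_mem hz₁ hz]
    · exact if_neg hz₁
  have key : ReflTransGen (G₁.restrict F₁).Adj (r a) (r b) := by
    refine ReflTransGen.lift' r ?_ _ _ (hc a (.inl ha) b (.inl hb))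
    rintro c d ⟨e, heF, hl⟩
    change ReflTransGen _ (r c) (r d)
    rcases h.isLink_iff.1 hl with hl | hl
    · rw [hr₁ c hl.left_mem, hr₁ d hl.right_mem]
      refine .single ⟨e, heF.resolve_right fun he => ?_, hl⟩
      exact Set.disjoint_left.1 h.disjoint hl.edge_mem (hF₂ he)
    · rw [hr₂ c hl.left_mem, hr₂ d hl.right_mem]
  rwa [hr₁ a ha, hr₁ b hb] at key

theorem reflTransGen_of_left (h : MeetAt G₁ G₂ v) (hxy : ReflTransGen (G₁.restrict F₁).Adj x y) :
    ReflTransGen ((blockSum G₁ G₂).restrict (F₁ ∪ F₂)).Adj x y :=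
  ReflTransGen.mono (fun _ _ ⟨e, he⟩ => ⟨e, .inl he.1, h.isLink_iff.2 (.inl he.2)⟩) _ _ hxy

theorem reflTransGen_of_right (h : MeetAt G₁ G₂ v) (hxy : ReflTransGen (G₂.restrict F₂).Adj x y) :
    ReflTransGen ((blockSum G₁ G₂).restrict (F₁ ∪ F₂)).Adj x y :=
  ReflTransGen.mono (fun _ _ ⟨e, he⟩ => ⟨e, .inr he.1, h.isLink_iff.2 (.inr he.2)⟩) _ _ hxy

theorem ncard_vertexSet (h : MeetAt G₁ G₂ v) (hV₁ : V(G₁).Finite) (hV₂ : V(G₂).Finite) :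
    V(blockSum G₁ G₂).ncard + 1 = V(G₁).ncard + V(G₂).ncard := by
  rw [← Set.ncard_union_add_ncard_inter _ _ hV₁ hV₂, h.inter_eq, Set.ncard_singleton]
  rfl

/-- In the forward direction, connectedness of each side bounds its vertex number by its edge number
plus one; the total count forces equality in both bounds. -/
theorem isSpanningTree_iff (h : MeetAt G₁ G₂ v) (hV₁ : V(G₁).Finite) (hV₂ : V(G₂).Finite)
    (hE₁ : E(G₁).Finite) (hE₂ : E(G₂).Finite) (hF₁ : F₁ ⊆ E(G₁)) (hF₂ : F₂ ⊆ E(G₂)) :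
    IsSpanningTree (blockSum G₁ G₂) (F₁ ∪ F₂) ↔ IsSpanningTree G₁ F₁ ∧ IsSpanningTree G₂ F₂ := by
  have hcardF : (F₁ ∪ F₂).ncard = F₁.ncard + F₂.ncard :=
    Set.ncard_union_eq (h.disjoint.mono hF₁ hF₂) (hE₁.subset hF₁) (hE₂.subset hF₂)
  have hcardV := h.ncard_vertexSet hV₁ hV₂
  constructor
  · rintro ⟨-, hc, hcard⟩
    have hc₁ := h.isPreconnected_left hF₂ hc
    have hc₂ := h.symm.isPreconnected_left hF₁ (by rwa [← h.blockSum_comm, Set.union_comm])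
    have h₁ := ncard_vertexSet_le_of_restrict hF₁ (hE₁.subset hF₁) hc₁
    have h₂ := ncard_vertexSet_le_of_restrict hF₂ (hE₂.subset hF₂) hc₂
    exact ⟨⟨hF₁, hc₁, by omega⟩, ⟨hF₂, hc₂, by omega⟩⟩
  · rintro ⟨⟨-, hc₁, hcard₁⟩, ⟨-, hc₂, hcard₂⟩⟩
    refine ⟨by rw [h.edgeSet_eq]; exact Set.union_subset_union hF₁ hF₂, ?_, by omega⟩
    have key : ∀ a ∈ V(blockSum G₁ G₂),
        ReflTransGen ((blockSum G₁ G₂).restrict (F₁ ∪ F₂)).Adj a v := by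
      rintro a (ha | ha)
      · exact h.reflTransGen_of_left (hc₁ a ha v h.mem_left)
      · exact h.reflTransGen_of_right (hc₂ a ha v h.symm.mem_left)
    exact fun a ha b hb => (key a ha).trans (reflTransGen_adj_symm (key b hb))

/-- Degrees add at v, but the shift by one is subtracted on both sides; `meetVector` restores one of
the two if v is a hyperedge. -/
theorem degreeVector_union (h : MeetAt G₁ G₂ v) (hE₁ : E(G₁).Finite) (hE₂ : E(G₂).Finite)
    (hF₁ : F₁ ⊆ E(G₁)) (hF₂ : F₂ ⊆ E(G₂)) :
    degreeVector (blockSum G₁ G₂) A (F₁ ∪ F₂) =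
      degreeVector G₁ A F₁ + degreeVector G₂ A F₂ + meetVector A v := by
  funext z
  have hcount : {e ∈ F₁ ∪ F₂ | (blockSum G₁ G₂).Inc e z}.ncard =
      {e ∈ F₁ | G₁.Inc e z}.ncard + {e ∈ F₂ | G₂.Inc e z}.ncard := by
    rw [← Set.ncard_union_eq ?_ (hE₁.subset fun _ h => hF₁ h.1) (hE₂.subset fun _ h => hF₂ h.1)]
    · congr 1
      ext e
      constructor
      · rintro ⟨he, hi⟩
        rcases h.inc_iff.1 hi with hi | hi
        · exact .inl ⟨he.resolve_right fun he =>
            Set.disjoint_left.1 h.disjoint hi.edge_mem (hF₂ he), hi⟩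
        · exact .inr ⟨he.resolve_left fun he =>
            Set.disjoint_left.1 h.disjoint (hF₁ he) hi.edge_mem, hi⟩
      · rintro (⟨he, hi⟩ | ⟨he, hi⟩)
        · exact ⟨.inl he, h.inc_iff.2 (.inl hi)⟩
        · exact ⟨.inr he, h.inc_iff.2 (.inr hi)⟩
    · exact (h.disjoint.mono hF₁ hF₂).mono (fun _ h => h.1) (fun _ h => h.1)
  have hzero : ∀ (G : Graph α β) (F : Set β), z ∉ V(G) → {e ∈ F | G.Inc e z}.ncard = 0 := by
    intro G F hz
    have : {e ∈ F | G.Inc e z} = ∅ :=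
      Set.eq_empty_iff_forall_notMem.2 fun e he => hz he.2.vertex_mem
    rw [this, Set.ncard_empty]
  simp only [Pi.add_apply, meetVector, Pi.single_apply]
  by_cases hzA : z ∈ A
  · by_cases hz₁ : z ∈ V(G₁) <;> by_cases hz₂ : z ∈ V(G₂)
    · obtain rfl := h.eq_of_mem hz₁ hz₂
      rw [degreeVector_of_mem (G := blockSum G₁ G₂) ⟨.inl hz₁, hzA⟩, degreeVector_of_mem ⟨hz₁, hzA⟩,
        degreeVector_of_mem ⟨hz₂, hzA⟩, hcount, if_pos rfl, if_pos hzA]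
      push_cast
      ring
    · rw [degreeVector_of_mem (G := blockSum G₁ G₂) ⟨.inl hz₁, hzA⟩, degreeVector_of_mem ⟨hz₁, hzA⟩,
        degreeVector_of_notMem (fun h => hz₂ h.1), hcount, hzero G₂ F₂ hz₂,
        if_neg (fun hv : z = v => hz₂ (hv ▸ h.symm.mem_left))]
      push_cast
      ring
    · rw [degreeVector_of_mem (G := blockSum G₁ G₂) ⟨.inr hz₂, hzA⟩, degreeVector_of_mem ⟨hz₂, hzA⟩,
        degreeVector_of_notMem (fun h => hz₁ h.1), hcount, hzero G₁ F₁ hz₁,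
        if_neg (fun hv : z = v => hz₁ (hv ▸ h.mem_left))]
      push_cast
      ring
    · rw [degreeVector_of_notMem (G := blockSum G₁ G₂) (fun h => h.1.elim hz₁ hz₂),
        degreeVector_of_notMem (fun h => hz₁ h.1), degreeVector_of_notMem (fun h => hz₂ h.1),
        if_neg (fun hv : z = v => hz₁ (hv ▸ h.mem_left))]
      rfl
  · rw [degreeVector_of_notMem (fun h => hzA h.2), degreeVector_of_notMem (fun h => hzA h.2),
      degreeVector_of_notMem (fun h => hzA h.2)]
    split_ifs with h₁ h₂
    · exact absurd (h₁ ▸ h₂) hzA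
    · rfl
    · rfl

theorem isHypertree_iff (h : MeetAt G₁ G₂ v) (hV₁ : V(G₁).Finite) (hV₂ : V(G₂).Finite)
    (hE₁ : E(G₁).Finite) (hE₂ : E(G₂).Finite) {f : α → ℤ} :
    IsHypertree (blockSum G₁ G₂) A f ↔ ∃ f₁ f₂, IsHypertree G₁ A f₁ ∧ IsHypertree G₂ A f₂ ∧
      f₁ + f₂ + meetVector A v = f := by
  have hV : V(blockSum G₁ G₂).Finite := hV₁.union hV₂
  have hE : E(blockSum G₁ G₂).Finite := h.edgeSet_eq ▸ hE₁.union hE₂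
  rw [InteriorPoly.isHypertree_iff hV hE]
  constructor
  · rintro ⟨F, hF, rfl⟩
    have hFeq : F = F ∩ E(G₁) ∪ F ∩ E(G₂) := by
      rw [← Set.inter_union_distrib_left, ← h.edgeSet_eq, Set.inter_eq_left.2 hF.1]
    rw [hFeq] at hF ⊢
    obtain ⟨h₁, h₂⟩ := (h.isSpanningTree_iff hV₁ hV₂ hE₁ hE₂ Set.inter_subset_right
      Set.inter_subset_right).1 hF
    exact ⟨_, _, (InteriorPoly.isHypertree_iff hV₁ hE₁).2 ⟨_, h₁, rfl⟩,
      (InteriorPoly.isHypertree_iff hV₂ hE₂).2 ⟨_, h₂, rfl⟩,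
      (h.degreeVector_union hE₁ hE₂ h₁.1 h₂.1).symm⟩
  · rintro ⟨f₁, f₂, hf₁, hf₂, rfl⟩
    obtain ⟨F₁, hF₁, rfl⟩ := (InteriorPoly.isHypertree_iff hV₁ hE₁).1 hf₁
    obtain ⟨F₂, hF₂, rfl⟩ := (InteriorPoly.isHypertree_iff hV₂ hE₂).1 hf₂
    exact ⟨F₁ ∪ F₂, (h.isSpanningTree_iff hV₁ hV₂ hE₁ hE₂ hF₁.1 hF₂.1).2 ⟨hF₁, hF₂⟩,
      h.degreeVector_union hE₁ hE₂ hF₁.1 hF₂.1⟩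

end MeetAt

theorem IsHypertree.apply_eq_zero {f : α → ℤ} (hf : IsHypertree G A f) (hx : x ∉ V(G)) : f x = 0 :=
  hf.1 x fun h => hx h.1

theorem IsHypertree.sum_vertexSet_eq (hV : V(G).Finite) (hE : E(G).Finite)
    (hA : IsBipartition G A) {W : Finset α} (hW : (W : Set α) = V(G)) {f g : α → ℤ}
    (hf : IsHypertree G A f) (hg : IsHypertree G A g) : ∑ x ∈ W, f x = ∑ x ∈ W, g x := by
  obtain ⟨E, hEA⟩ := (hV.subset (Set.inter_subset_left (t := A))).exists_finset_coe
  have hEW : E ⊆ W := by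
    rw [← Finset.coe_subset, hEA, hW]
    exact Set.inter_subset_left
  have key : ∀ f, IsHypertree G A f → ∑ x ∈ W, f x = ∑ x ∈ E, f x := fun f hf =>
    (Finset.sum_subset hEW fun x _ hx => hf.1 x (by rwa [← hEA, Finset.mem_coe])).symm
  rw [key f hf, key g hg, IsHypertree.sum_eq hV hE hA hEA hf, IsHypertree.sum_eq hV hE hA hEA hg]

/-- Lets the constant coordinate sum of hypertrees determine the value at v, the one place where the
two sides overlap. -/
theorem eq_of_sum_eq_of_eq_off {W : Finset α} (hv : v ∈ W) {f g : α → ℤ}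
    (hsum : ∑ x ∈ W, f x = ∑ x ∈ W, g x) (hoff : ∀ z ≠ v, f z = g z) : f = g := by
  classical
  funext z
  by_cases hz : z = v
  · subst hz
    rw [← Finset.add_sum_erase _ _ hv, ← Finset.add_sum_erase _ _ hv,
      Finset.sum_congr rfl fun w hw => hoff w (Finset.ne_of_mem_erase hw)] at hsum
    exact add_right_cancel hsum
  · exact hoff z hz

theorem sum_transfer {W : Finset α} (hx : x ∈ W) (hy : y ∈ W) (f : α → ℤ) :
    ∑ z ∈ W, transfer f x y z = ∑ z ∈ W, f z := by
  classical
  simp only [transfer_apply, Finset.sum_add_distrib, Finset.sum_sub_distrib, Finset.sum_ite_eq',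
    if_pos hx, if_pos hy]
  ring

namespace MeetAt

variable {f₁ f₂ f₁' f₂' : α → ℤ}

/-- On `G₁` away from v the other summands vanish, so `f₁'` can be read off from the sum; its value
at v follows from the coordinate sum. -/
theorem transfer_of_right_zero (h : MeetAt G₁ G₂ v) (hV₁ : V(G₁).Finite) (hE₁ : E(G₁).Finite)
    (hA₁ : IsBipartition G₁ A) (hf₁ : IsHypertree G₁ A f₁) (hf₁' : IsHypertree G₁ A f₁')
    (hf₂ : IsHypertree G₂ A f₂) (hf₂' : IsHypertree G₂ A f₂') (hx : x ∈ V(G₁)) (hy : y ∈ V(G₁))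
    {p f : α → ℤ} (hp : ∀ z ≠ v, p z = 0) (hf : f₁' + f₂' + p = f)
    (hoff : ∀ z ≠ v, z ∈ V(G₁) → f z = transfer (f₁ + f₂ + p) x y z) :
    f₁' = transfer f₁ x y := by
  subst hf
  obtain ⟨W, hW⟩ := hV₁.exists_finset_coe
  have hmem : ∀ z, z ∈ W ↔ z ∈ V(G₁) := fun z => by rw [← Finset.mem_coe, hW]
  refine eq_of_sum_eq_of_eq_off ((hmem v).2 h.mem_left) ?_ fun z hz => ?_
  · rw [sum_transfer ((hmem x).2 hx) ((hmem y).2 hy)]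
    exact hf₁'.sum_vertexSet_eq hV₁ hE₁ hA₁ hW hf₁
  · by_cases hz₁ : z ∈ V(G₁)
    · have hz₂ : z ∉ V(G₂) := fun hz₂ => hz (h.eq_of_mem hz₁ hz₂)
      have := hoff z hz hz₁
      rw [transfer_apply] at this ⊢
      simpa [hp z hz, hf₂.apply_eq_zero hz₂, hf₂'.apply_eq_zero hz₂] using this
    · have hzx : z ≠ x := fun hzx => hz₁ (hzx ▸ hx)
      have hzy : z ≠ y := fun hzy => hz₁ (hzy ▸ hy)
      rw [transfer_apply, if_neg hzx, if_neg hzy, hf₁.apply_eq_zero hz₁, hf₁'.apply_eq_zero hz₁]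
      rfl

theorem eq_of_add_eq (h : MeetAt G₁ G₂ v) (hV₁ : V(G₁).Finite) (hE₁ : E(G₁).Finite)
    (hA₁ : IsBipartition G₁ A) (hf₁ : IsHypertree G₁ A f₁) (hf₁' : IsHypertree G₁ A f₁')
    (hf₂ : IsHypertree G₂ A f₂) (hf₂' : IsHypertree G₂ A f₂') (heq : f₁' + f₂' = f₁ + f₂) :
    f₁' = f₁ := by
  classical
  -- A transfer from v to itself changes nothing.
  have := h.transfer_of_right_zero hV₁ hE₁ hA₁ hf₁ hf₁' hf₂ hf₂' h.mem_left h.mem_left (p := 0)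
    (fun _ _ => rfl) (f := f₁ + f₂) (by simpa using heq) (fun z _ _ => by simp [transfer])
  simpa [transfer] using this

/-- If the unit leaves x for a hyperedge outside `G₁`, the constant sum on `G₁` shows that within
`G₁` it went to v, which is smaller than x. Conversely, a transfer inside `G₁` leaves `f₂`
untouched. -/
theorem mem_internallyInactive_iff (h : MeetAt G₁ G₂ v) (hV₁ : V(G₁).Finite) (hV₂ : V(G₂).Finite)
    (hE₁ : E(G₁).Finite) (hE₂ : E(G₂).Finite) (hA₁ : IsBipartition G₁ A) {o : LinearOrder α}
    (ho : ∀ z, z ≠ v → o.lt v z) (hf₁ : IsHypertree G₁ A f₁) (hf₂ : IsHypertree G₂ A f₂)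
    (hx : x ∈ V(G₁)) (hxv : x ≠ v) :
    x ∈ internallyInactive (blockSum G₁ G₂) A o
        (f₁ + f₂ + meetVector A v) ↔ x ∈ internallyInactive G₁ A o f₁ := by
  constructor
  · rintro ⟨⟨-, hxA⟩, y, ⟨hyV, hyA⟩, hyx, hT⟩
    obtain ⟨f₁', f₂', hf₁', hf₂', hf⟩ := (h.isHypertree_iff hV₁ hV₂ hE₁ hE₂).1 hT
    refine ⟨⟨hx, hxA⟩, ?_⟩
    by_cases hy : y ∈ V(G₁)
    · have := h.transfer_of_right_zero hV₁ hE₁ hA₁ hf₁ hf₁' hf₂ hf₂' hx hy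
        (fun _ => meetVector_of_ne) hf fun _ _ _ => rfl
      exact ⟨y, ⟨hy, hyA⟩, hyx, this ▸ hf₁'⟩
    · have := h.transfer_of_right_zero hV₁ hE₁ hA₁ hf₁ hf₁' hf₂ hf₂' hx h.mem_left
        (fun _ => meetVector_of_ne) hf fun z hz hz₁ => by
          have hzy : z ≠ y := fun hzy => hy (hzy ▸ hz₁)
          rw [transfer_apply, transfer_apply, if_neg hzy, if_neg hz]
      refine ⟨v, ⟨h.mem_left, ?_⟩, ho x hxv, this ▸ hf₁'⟩
      -- If v were no hyperedge, hypertrees would vanish at v and could not gain a unit there.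
      by_contra hvA
      have hval := congrFun this v
      rw [transfer_apply, if_neg hxv.symm, if_pos rfl, hf₁.1 v (fun h => hvA h.2),
        hf₁'.1 v (fun h => hvA h.2)] at hval
      omega
  · rintro ⟨⟨-, hxA⟩, y, ⟨hyV, hyA⟩, hyx, hT⟩
    refine ⟨⟨.inl hx, hxA⟩, y, ⟨.inl hyV, hyA⟩, hyx,
      (h.isHypertree_iff hV₁ hV₂ hE₁ hE₂).2 ⟨_, f₂, hT, hf₂, ?_⟩⟩
    simp only [transfer]
    abel

theorem ncard_internallyInactive (h : MeetAt G₁ G₂ v) (hV₁ : V(G₁).Finite) (hV₂ : V(G₂).Finite)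
    (hE₁ : E(G₁).Finite) (hE₂ : E(G₂).Finite) (hA₁ : IsBipartition G₁ A)
    (hA₂ : IsBipartition G₂ A) {o : LinearOrder α} (ho : ∀ z, z ≠ v → o.lt v z)
    (hf₁ : IsHypertree G₁ A f₁) (hf₂ : IsHypertree G₂ A f₂) :
    (internallyInactive (blockSum G₁ G₂) A o
        (f₁ + f₂ + meetVector A v)).ncard =
      (internallyInactive G₁ A o f₁).ncard + (internallyInactive G₂ A o f₂).ncard := by
  have hv : ∀ (G : Graph α β) f, v ∉ internallyInactive G A o f := by
    rintro G f ⟨-, y, -, hyv, -⟩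
    by_cases hy : y = v
    · exact lt_irrefl _ (hy ▸ hyv)
    · exact lt_asymm hyv (ho y hy)
  have h₁ := fun x => h.mem_internallyInactive_iff (x := x) hV₁ hV₂ hE₁ hE₂ hA₁ ho hf₁ hf₂
  have h₂ := fun x => h.symm.mem_internallyInactive_iff (x := x) hV₂ hV₁ hE₂ hE₁ hA₂ ho hf₂ hf₁
  rw [← h.blockSum_comm, add_comm f₂ f₁] at h₂
  rw [← Set.ncard_union_eq ?_ (hV₁.subset fun _ h => h.1.1) (hV₂.subset fun _ h => h.1.1)]
  · congr 1
    ext x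
    by_cases hxv : x = v
    · subst hxv
      exact ⟨fun h => absurd h (hv _ _), fun h => h.elim (absurd · (hv _ _)) (absurd · (hv _ _))⟩
    constructor
    · intro hx
      rcases hx.1.1 with hx' | hx'
      · exact .inl ((h₁ x hx' hxv).1 hx)
      · exact .inr ((h₂ x hx' hxv).1 hx)
    · rintro (hx | hx)
      · exact (h₁ x hx.1.1 hxv).2 hx
      · exact (h₂ x hx.1.1 hxv).2 hx
  · exact Set.disjoint_left.2 fun x hx hx' => hv _ _ (h.eq_of_mem hx.1.1 hx'.1.1 ▸ hx)

/-- The interior polynomial is multiplicative under block sums. -/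
theorem interior_blockSum (h : MeetAt G₁ G₂ v) (hV₁ : V(G₁).Finite) (hV₂ : V(G₂).Finite)
    (hE₁ : E(G₁).Finite) (hE₂ : E(G₂).Finite) (hA₁ : IsBipartition G₁ A)
    (hA₂ : IsBipartition G₂ A) (o₁ o₂ o : LinearOrder α) :
    interior (blockSum G₁ G₂) A o = interior G₁ A o₁ * interior G₂ A o₂ := by
  classical
  have hV : V(blockSum G₁ G₂).Finite := hV₁.union hV₂
  have hE : E(blockSum G₁ G₂).Finite := h.edgeSet_eq ▸ hE₁.union hE₂
  obtain ⟨o', ho'⟩ := exists_linearOrder_min o v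
  rw [interior_eq hV hE (h.isBipartition hA₁ hA₂) o o', interior_eq hV₁ hE₁ hA₁ o₁ o',
    interior_eq hV₂ hE₂ hA₂ o₂ o']
  have hsum : ∀ (G : Graph α β) (hG : {f | IsHypertree G A f}.Finite), interior G A o' =
      ∑ f ∈ hG.toFinset, X ^ (internallyInactive G A o' f).ncard := fun G hG =>
    finsum_mem_eq_finite_toFinset_sum _ hG
  rw [hsum _ (finite_isHypertree hV hE), hsum _ (finite_isHypertree hV₁ hE₁),
    hsum _ (finite_isHypertree hV₂ hE₂), Finset.sum_mul_sum, ← Finset.sum_product']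
  symm
  refine Finset.sum_bij (fun p _ => p.1 + p.2 + meetVector A v) ?_ ?_ ?_ ?_
  · rintro ⟨f₁, f₂⟩ hf
    simp only [Finset.mem_product, Set.Finite.mem_toFinset, Set.mem_ofPred_eq] at hf ⊢
    exact (h.isHypertree_iff hV₁ hV₂ hE₁ hE₂).2 ⟨f₁, f₂, hf.1, hf.2, rfl⟩
  · rintro ⟨f₁, f₂⟩ hf ⟨f₁', f₂'⟩ hf' heq
    simp only [Finset.mem_product, Set.Finite.mem_toFinset, Set.mem_ofPred_eq] at hf hf'
    have heq' : f₁ + f₂ = f₁' + f₂' := add_right_cancel heq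
    obtain rfl := h.eq_of_add_eq hV₁ hE₁ hA₁ hf'.1 hf.1 hf'.2 hf.2 heq'
    rw [add_left_cancel heq']
  · intro f hf
    simp only [Set.Finite.mem_toFinset, Set.mem_ofPred_eq] at hf
    obtain ⟨f₁, f₂, hf₁, hf₂, rfl⟩ := (h.isHypertree_iff hV₁ hV₂ hE₁ hE₂).1 hf
    exact ⟨(f₁, f₂), by simp [hf₁, hf₂], rfl⟩
  · rintro ⟨f₁, f₂⟩ hf
    simp only [Finset.mem_product, Set.Finite.mem_toFinset, Set.mem_ofPred_eq] at hf
    rw [h.ncard_internallyInactive hV₁ hV₂ hE₁ hE₂ hA₁ hA₂ ho' hf.1 hf.2, pow_add]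

end MeetAt

end BlockSum

/-! ### Disconnected graphs and signs -/

section Components

variable {α β : Type*} {G G₁ G₂ : Graph α β} {A : Set α} {v x y z : α} {S : Set β}

open Relation

/-- The component of `G` that contains the vertex `x`. -/
def component (G : Graph α β) (x : α) : Graph α β :=
  G.induce {y | ReflTransGen G.Adj x y}

theorem mem_component_iff : y ∈ V(component G x) ↔ ReflTransGen G.Adj x y := Iff.rfl

theorem component_eq (h : ReflTransGen G.Adj x y) : component G x = component G y :=
  congrArg G.induce (Set.ext fun _ =>
    ⟨fun h' => (reflTransGen_adj_symm h).trans h', fun h' => h.trans h'⟩)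

theorem component_eq_iff : component G x = component G y ↔ ReflTransGen G.Adj x y :=
  ⟨fun h => mem_component_iff.1 (h ▸ mem_component_iff.2 .refl), component_eq⟩

theorem vertexSet_component_subset (hx : x ∈ V(G)) : V(component G x) ⊆ V(G) :=
  fun _ h => mem_of_reflTransGen_adj hx h

theorem edgeSet_component_subset : E(component G x) ⊆ E(G) := by
  rintro e ⟨a, b, h, -, -⟩
  exact h.edge_mem

theorem isBipartition_component (hA : IsBipartition G A) : IsBipartition (component G x) A :=
  fun _ _ _ h => hA h.1

theorem finite_components (hV : V(G).Finite) : (components G).Finite :=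
  (hV.image (component G)).subset fun _ ⟨x, hx, h⟩ => ⟨x, hx, h.symm⟩

/-- Setting one component apart makes the exponent k - 1 the number of the others, without truncated
subtraction. -/
theorem interior'_eq (hV : V(G).Finite) (hx : x ∈ V(G)) (o : LinearOrder α) :
    interior' G A o = (1 - X) ^ (components G \ {component G x}).ncard *
      (interior (component G x) A o *
        ∏ᶠ (H : Graph α β) (_ : H ∈ components G \ {component G x}), interior H A o) := by
  have hmem : component G x ∈ components G := ⟨x, hx, rfl⟩
  have hfin : (components G \ {component G x}).Finite :=
    (finite_components hV).subset Set.sdiff_subset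
  rw [interior', Set.ncard_sdiff_singleton_of_mem hmem,
    ← finprod_mem_insert (fun H => interior H A o) (fun h => h.2 rfl) hfin, Set.insert_sdiff_self_of_mem hmem]

theorem interior_component_eq (hV : V(G).Finite) (hE : E(G).Finite) (hA : IsBipartition G A)
    (o o' : LinearOrder α) {H : Graph α β} (hH : H ∈ components G) :
    interior H A o = interior H A o' := by
  obtain ⟨x, hx, rfl⟩ := hH
  exact interior_eq (hV.subset (vertexSet_component_subset hx))
    (hE.subset (edgeSet_component_subset (x := x))) (isBipartition_component hA) o o'

namespace MeetAt

theorem reflTransGen_left (h : MeetAt G₁ G₂ v) (hxy : ReflTransGen G₁.Adj x y) :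
    ReflTransGen (blockSum G₁ G₂).Adj x y :=
  ReflTransGen.mono (fun _ _ ⟨e, he⟩ => ⟨e, h.isLink_iff.2 (.inl he)⟩) _ _ hxy

theorem reflTransGen_right (h : MeetAt G₁ G₂ v) (hxy : ReflTransGen G₂.Adj x y) :
    ReflTransGen (blockSum G₁ G₂).Adj x y :=
  ReflTransGen.mono (fun _ _ ⟨e, he⟩ => ⟨e, h.isLink_iff.2 (.inr he)⟩) _ _ hxy

/-- A walk can pass from `G₁` to `G₂` only through v. -/
theorem component_left (h : MeetAt G₁ G₂ v) (hx : x ∈ V(G₁)) (hxv : ¬ ReflTransGen G₁.Adj x v) :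
    component (blockSum G₁ G₂) x = component G₁ x := by
  have hno : ∀ c, ReflTransGen G₁.Adj x c → c ∉ V(G₂) := fun c hc hc₂ =>
    hxv (h.eq_of_mem (mem_of_reflTransGen_adj hx hc) hc₂ ▸ hc)
  have hreach : ∀ y, ReflTransGen (blockSum G₁ G₂).Adj x y ↔ ReflTransGen G₁.Adj x y := by
    refine fun y => ⟨fun hy => ?_, h.reflTransGen_left⟩
    induction hy with
    | refl => exact .refl
    | @tail c d _ hcd ih =>
      obtain ⟨e, he⟩ := hcd
      rcases h.isLink_iff.1 he with he | he
      · exact ih.tail ⟨e, he⟩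
      · exact absurd he.left_mem (hno c ih)
  refine Graph.ext (Set.ext hreach) fun e a b => ?_
  simp only [component, Graph.induce_isLink, h.isLink_iff, hreach]
  refine ⟨fun ⟨hl, ha, hb⟩ => ⟨hl.resolve_right fun hl => hno a ha hl.left_mem, ha, hb⟩,
    fun ⟨hl, ha, hb⟩ => ⟨.inl hl, ha, hb⟩⟩

theorem component_right (h : MeetAt G₁ G₂ v) (hx : x ∈ V(G₂)) (hxv : ¬ ReflTransGen G₂.Adj x v) :
    component (blockSum G₁ G₂) x = component G₂ x := by
  rw [h.blockSum_comm]
  exact h.symm.component_left hx hxv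

theorem meetAt_component (h : MeetAt G₁ G₂ v) : MeetAt (component G₁ v) (component G₂ v) v where
  inter_eq := by
    refine Set.Subset.antisymm (fun z hz => ?_) ?_
    · exact h.eq_of_mem (vertexSet_component_subset h.mem_left hz.1)
        (vertexSet_component_subset h.symm.mem_left hz.2)
    · rintro _ rfl
      exact ⟨ReflTransGen.refl, ReflTransGen.refl⟩
  disjoint := h.disjoint.mono edgeSet_component_subset edgeSet_component_subset

theorem component_meet (h : MeetAt G₁ G₂ v) :
    component (blockSum G₁ G₂) v = blockSum (component G₁ v) (component G₂ v) := by
  have hreach : ∀ y, ReflTransGen (blockSum G₁ G₂).Adj v y ↔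
      ReflTransGen G₁.Adj v y ∨ ReflTransGen G₂.Adj v y := by
    refine fun y => ⟨fun hy => ?_, fun hy => hy.elim h.reflTransGen_left h.reflTransGen_right⟩
    induction hy with
    | refl => exact .inl .refl
    | @tail c d _ hcd ih =>
      obtain ⟨e, he⟩ := hcd
      rcases h.isLink_iff.1 he with he | he
      · refine .inl (ReflTransGen.tail ?_ ⟨e, he⟩)
        rcases ih with ih | ih
        · exact ih
        · rw [h.eq_of_mem he.left_mem (mem_of_reflTransGen_adj h.symm.mem_left ih)]
      · refine .inr (ReflTransGen.tail ?_ ⟨e, he⟩)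
        rcases ih with ih | ih
        · rw [h.eq_of_mem (mem_of_reflTransGen_adj h.mem_left ih) he.left_mem]
        · exact ih
  refine Graph.ext (Set.ext hreach) fun e a b => ?_
  rw [h.meetAt_component.isLink_iff]
  simp only [component, Graph.induce_isLink, h.isLink_iff, Set.mem_ofPred_eq, hreach]
  have h₁ : ∀ c ∈ V(G₁), ReflTransGen G₂.Adj v c → ReflTransGen G₁.Adj v c := fun c hc hvc => by
    rw [h.eq_of_mem hc (mem_of_reflTransGen_adj h.symm.mem_left hvc)]
  have h₂ : ∀ c ∈ V(G₂), ReflTransGen G₁.Adj v c → ReflTransGen G₂.Adj v c := fun c hc hvc => by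
    rw [h.eq_of_mem (mem_of_reflTransGen_adj h.mem_left hvc) hc]
  constructor
  · rintro ⟨hl | hl, ha, hb⟩
    · exact .inl ⟨hl, ha.elim id (h₁ a hl.left_mem), hb.elim id (h₁ b hl.right_mem)⟩
    · exact .inr ⟨hl, ha.elim (h₂ a hl.left_mem) id, hb.elim (h₂ b hl.right_mem) id⟩
  · rintro (⟨hl, ha, hb⟩ | ⟨hl, ha, hb⟩)
    · exact ⟨.inl hl, .inl ha, .inl hb⟩
    · exact ⟨.inr hl, .inr ha, .inr hb⟩

/-- Only the components through v merge. With the disjointness proved next, this makes the exponents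
of 1 - X add. -/
theorem components_diff_eq (h : MeetAt G₁ G₂ v) :
    components (blockSum G₁ G₂) \ {component (blockSum G₁ G₂) v} =
      (components G₁ \ {component G₁ v}) ∪ (components G₂ \ {component G₂ v}) := by
  have hsub : ∀ {G₁ G₂ : Graph α β}, MeetAt G₁ G₂ v → components G₁ \ {component G₁ v} ⊆
      components (blockSum G₁ G₂) \ {component (blockSum G₁ G₂) v} := by
    rintro G₁ G₂ h _ ⟨⟨x, hx, rfl⟩, hne⟩
    have hxv : ¬ ReflTransGen G₁.Adj x v := fun hxv => hne (component_eq hxv)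
    have heq := h.component_left hx hxv
    change component G₁ x ∈ _
    refine ⟨⟨x, .inl hx, heq.symm⟩, fun hv => hxv ?_⟩
    rw [Set.mem_singleton_iff] at hv
    exact mem_component_iff.1 (hv ▸ mem_component_iff.2 .refl)
  refine Set.Subset.antisymm ?_ (Set.union_subset (hsub h) (h.blockSum_comm ▸ hsub h.symm))
  rintro _ ⟨⟨x, hx | hx, rfl⟩, hne⟩
  · have hxv : ¬ ReflTransGen G₁.Adj x v := fun hxv =>
      hne (component_eq (h.reflTransGen_left hxv))
    have heq : component (blockSum G₁ G₂) x = _ := h.component_left hx hxv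
    exact .inl ⟨⟨x, hx, heq⟩, fun hv => hxv (component_eq_iff.1 (heq.symm.trans hv))⟩
  · have hxv : ¬ ReflTransGen G₂.Adj x v := fun hxv =>
      hne (component_eq (h.reflTransGen_right hxv))
    have heq : component (blockSum G₁ G₂) x = _ := h.component_right hx hxv
    exact .inr ⟨⟨x, hx, heq⟩, fun hv => hxv (component_eq_iff.1 (heq.symm.trans hv))⟩

theorem disjoint_components (h : MeetAt G₁ G₂ v) :
    Disjoint (components G₁ \ {component G₁ v}) (components G₂ \ {component G₂ v}) := by
  refine Set.disjoint_left.2 ?_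
  rintro _ ⟨⟨x, hx, rfl⟩, hne⟩ ⟨⟨y, hy, heq⟩, -⟩
  have heq' : component G₁ x = component G₂ y := heq
  have hmem : x ∈ V(component G₂ y) := heq' ▸ mem_component_iff.2 .refl
  exact hne (congrArg (component G₁) (h.eq_of_mem hx (vertexSet_component_subset hy hmem)))

/-- The polynomial `I'` is multiplicative under block sums. -/
theorem interior'_blockSum (h : MeetAt G₁ G₂ v) (hV₁ : V(G₁).Finite) (hV₂ : V(G₂).Finite)
    (hE₁ : E(G₁).Finite) (hE₂ : E(G₂).Finite) (hA₁ : IsBipartition G₁ A)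
    (hA₂ : IsBipartition G₂ A) (o₁ o₂ o : LinearOrder α) :
    interior' (blockSum G₁ G₂) A o = interior' G₁ A o₁ * interior' G₂ A o₂ := by
  have hfin₁ : (components G₁ \ {component G₁ v}).Finite :=
    (finite_components hV₁).subset Set.sdiff_subset
  have hfin₂ : (components G₂ \ {component G₂ v}).Finite :=
    (finite_components hV₂).subset Set.sdiff_subset
  rw [interior'_eq (G := blockSum G₁ G₂) (hV₁.union hV₂) (.inl h.mem_left) o,
    interior'_eq hV₁ h.mem_left o₁, interior'_eq hV₂ h.symm.mem_left o₂, h.components_diff_eq,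
    Set.ncard_union_eq h.disjoint_components hfin₁ hfin₂, h.component_meet,
    h.meetAt_component.interior_blockSum (hV₁.subset (vertexSet_component_subset h.mem_left))
      (hV₂.subset (vertexSet_component_subset h.symm.mem_left))
      (hE₁.subset edgeSet_component_subset) (hE₂.subset edgeSet_component_subset)
      (isBipartition_component hA₁) (isBipartition_component hA₂) o₁ o₂ o,
    finprod_mem_union h.disjoint_components hfin₁ hfin₂,
    finprod_mem_congr rfl fun H hH => interior_component_eq hV₁ hE₁ hA₁ o o₁ hH.1,
    finprod_mem_congr rfl fun H hH => interior_component_eq hV₂ hE₂ hA₂ o o₂ hH.1, pow_add]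
  ring

theorem deleteEdges (h : MeetAt G₁ G₂ v) (S₁ S₂ : Set β) :
    MeetAt (G₁.deleteEdges S₁) (G₂.deleteEdges S₂) v :=
  ⟨h.inter_eq, h.disjoint.mono Set.sdiff_subset Set.sdiff_subset⟩

theorem blockSum_deleteEdges (h : MeetAt G₁ G₂ v) {S₁ S₂ : Set β} (hS₁ : S₁ ⊆ E(G₁))
    (hS₂ : S₂ ⊆ E(G₂)) : (blockSum G₁ G₂).deleteEdges (S₁ ∪ S₂) =
      blockSum (G₁.deleteEdges S₁) (G₂.deleteEdges S₂) := by
  refine Graph.ext rfl fun e x y => ?_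
  rw [(h.deleteEdges S₁ S₂).isLink_iff]
  simp only [Graph.deleteEdges_isLink, h.isLink_iff, Set.mem_union]
  have h₁ : G₁.IsLink e x y → e ∉ S₂ := fun hl he =>
    Set.disjoint_left.1 h.disjoint hl.edge_mem (hS₂ he)
  have h₂ : G₂.IsLink e x y → e ∉ S₁ := fun hl he =>
    Set.disjoint_left.1 h.disjoint (hS₁ he) hl.edge_mem
  tauto

theorem negEdges_blockSum (h : MeetAt G₁ G₂ v) (σ : β → ℤˣ) :
    negEdges (blockSum G₁ G₂) σ = negEdges G₁ σ ∪ negEdges G₂ σ := by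
  ext e
  simp only [negEdges, h.edgeSet_eq, Set.mem_union, Set.mem_ofPred_eq]
  tauto

/-- The signed interior polynomial is multiplicative under block sums. -/
theorem signedInterior_blockSum (h : MeetAt G₁ G₂ v) (hV₁ : V(G₁).Finite) (hV₂ : V(G₂).Finite)
    (hE₁ : E(G₁).Finite) (hE₂ : E(G₂).Finite) (hA₁ : IsBipartition G₁ A)
    (hA₂ : IsBipartition G₂ A) (σ : β → ℤˣ) (o₁ o₂ o : LinearOrder α) :
    signedInterior (blockSum G₁ G₂) A σ o = signedInterior G₁ A σ o₁ * signedInterior G₂ A σ o₂ := by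
  have hN₁ : negEdges G₁ σ ⊆ E(G₁) := fun _ h => h.1
  have hN₂ : negEdges G₂ σ ⊆ E(G₂) := fun _ h => h.1
  have hdisj := h.disjoint.mono hN₁ hN₂
  have hfin₁ := (hE₁.subset hN₁).finite_subsets
  have hfin₂ := (hE₂.subset hN₂).finite_subsets
  have hfin : {S | S ⊆ negEdges (blockSum G₁ G₂) σ}.Finite := by
    rw [h.negEdges_blockSum]
    exact ((hE₁.subset hN₁).union (hE₂.subset hN₂)).finite_subsets
  have hsum : ∀ (G : Graph α β) (o : LinearOrder α) (hG : {S | S ⊆ negEdges G σ}.Finite),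
      signedInterior G A σ o =
        ∑ S ∈ hG.toFinset, (-1) ^ S.ncard * interior' (G.deleteEdges S) A o :=
    fun G o hG => finsum_mem_eq_finite_toFinset_sum _ hG
  rw [hsum _ o hfin, hsum _ o₁ hfin₁, hsum _ o₂ hfin₂, Finset.sum_mul_sum, ← Finset.sum_product']
  symm
  -- A set of negative edges of the block sum splits uniquely into its parts in `G₁` and `G₂`.
  refine Finset.sum_bij (fun p _ => p.1 ∪ p.2) ?_ ?_ ?_ ?_
  · rintro ⟨S₁, S₂⟩ hS
    simp only [Finset.mem_product, Set.Finite.mem_toFinset, Set.mem_ofPred_eq] at hS ⊢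
    rw [h.negEdges_blockSum]
    exact Set.union_subset_union hS.1 hS.2
  · rintro ⟨S₁, S₂⟩ hS ⟨T₁, T₂⟩ hT heq
    simp only [Finset.mem_product, Set.Finite.mem_toFinset, Set.mem_ofPred_eq] at hS hT heq
    have key : ∀ {N₁ N₂ S₁ S₂ : Set β}, Disjoint N₁ N₂ → S₁ ⊆ N₁ → S₂ ⊆ N₂ →
        (S₁ ∪ S₂) ∩ N₁ = S₁ := fun hN h₁ h₂ => by
      rw [Set.union_inter_distrib_right, Set.inter_eq_left.2 h₁,
        ((hN.mono_right h₂).symm).inter_eq, Set.union_empty]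
    have e₁ : S₁ = T₁ := by rw [← key hdisj hS.1 hS.2, heq, key hdisj hT.1 hT.2]
    have e₂ : S₂ = T₂ := by
      rw [← key hdisj.symm hS.2 hS.1, Set.union_comm, heq, Set.union_comm,
        key hdisj.symm hT.2 hT.1]
    rw [e₁, e₂]
  · intro S hS
    simp only [Set.Finite.mem_toFinset, Set.mem_ofPred_eq] at hS
    refine ⟨(S ∩ negEdges G₁ σ, S ∩ negEdges G₂ σ), by simp, ?_⟩
    rw [← Set.inter_union_distrib_left, ← h.negEdges_blockSum, Set.inter_eq_left.2 hS]
  · rintro ⟨S₁, S₂⟩ hS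
    simp only [Finset.mem_product, Set.Finite.mem_toFinset, Set.mem_ofPred_eq] at hS ⊢
    have h₁ := hS.1.trans hN₁
    have h₂ := hS.2.trans hN₂
    rw [h.blockSum_deleteEdges h₁ h₂,
      (h.deleteEdges S₁ S₂).interior'_blockSum (G₁ := G₁.deleteEdges S₁)
        (G₂ := G₂.deleteEdges S₂) hV₁ hV₂ (hE₁.subset Set.sdiff_subset)
        (hE₂.subset Set.sdiff_subset) (fun _ _ _ hl => hA₁ hl.1) (fun _ _ _ hl => hA₂ hl.1)
        o₁ o₂ o,
      Set.ncard_union_eq (h.disjoint.mono h₁ h₂) (hE₁.subset h₁) (hE₂.subset h₂), pow_add]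
    ring

end MeetAt

end Components

end InteriorPoly

theorem mainTheorem7 {α β : Type*} (G₁ G₂ : Graph α β)
    (hV₁ : G₁.vertexSet.Finite) (hE₁ : G₁.edgeSet.Finite)
    (hV₂ : G₂.vertexSet.Finite) (hE₂ : G₂.edgeSet.Finite)
    (v : α) (hV : G₁.vertexSet ∩ G₂.vertexSet = {v}) (hE : Disjoint G₁.edgeSet G₂.edgeSet)
    (A : Set α) (hA₁ : InteriorPoly.IsBipartition G₁ A) (hA₂ : InteriorPoly.IsBipartition G₂ A)
    (σ : β → ℤˣ) (o₁ o₂ o : LinearOrder α) :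
    InteriorPoly.signedInterior (InteriorPoly.blockSum G₁ G₂) A σ o =
        InteriorPoly.signedInterior G₁ A σ o₁ * InteriorPoly.signedInterior G₂ A σ o₂ ∧
      InteriorPoly.interior' (InteriorPoly.blockSum G₁ G₂) A o =
        InteriorPoly.interior' G₁ A o₁ * InteriorPoly.interior' G₂ A o₂ := by
  have h : InteriorPoly.MeetAt G₁ G₂ v := ⟨hV, hE⟩
  exact ⟨h.signedInterior_blockSum hV₁ hV₂ hE₁ hE₂ hA₁ hA₂ σ o₁ o₂ o,
    h.interior'_blockSum hV₁ hV₂ hE₁ hE₂ hA₁ hA₂ o₁ o₂ o⟩
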